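/- Let $P$ be a probability measure on $\mathbb R^d$, let $X_1,X_2,\dots$ be i.i.d. with law $P$, and write $Rf=\int f\,dR$, $P_n=\frac1n\sum_{i=1}^n\delta_{X_i}$, $\gamma_n(f)=\sqrt n\,(P_n-P)f$. Let $\mathcal F$ be a class of measurable functions $\mathbb R^d\to\mathbb R$ with an envelope, i.e. there is $F:\mathbb R^d\to\mathbb R$ with $|f|\le F$ for all $f\in\mathcal F$. A $P$-Brownian bridge on $\mathcal F\subset L^2(P)$ is a centered Gaussian process $(B(f))_{f\in\mathcal F}$ with covariance $P(fg)-Pf\,Pg$. The class $\mathcal F$ is called pregaussian if there is a $P$-Brownian bridge on $\mathcal F$ with almost all sample paths bounded on $\mathcal F$ and uniformly continuous for $\rho_P(f,g)=\mathrm{Var}_P(f-g)^{1/2}$. It is called $KMT(\delta_n;P)$ if it is pregaussian and, on some probability space carrying an i.i.d. sequence with law $P$ (with empirical measures again denoted $P_n$), there are $P$-Brownian bridges $B_n^0$ on $\mathcal F$ and constants $b,c,\theta>0$ such that, for all $n\ge1$ and $t>0$, $$\Pr\Big\{\sup_{f\in\mathcal F}\big|\sqrt n(P_n-P)f-B^0_n(f)\big|\ge\delta_n(t+b\log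 n)\Big\}\le c\,e^{-\theta t}.$$ Let $(a_f)_{f\in\mathcal F}$ be real numbers and let $\Omega$ be the set of signed measures $Q$ on $\mathbb R^d$ with total mass $1$ that integrate every $f\in\mathcal F$ and satisfy $Qf=a_f$ for all $f\in\mathcal F$; fix $Q_0\in\Omega$. Let $\mathcal F_1\subseteq\mathcal F_2\subseteq\cdots\subseteq\mathcal F$ be finite sets of linearly independent functions, $k=k(n)=\mathrm{card}\,\mathcal F_n$. Let $S_k$ be the matrix with entries $P(fg)-Pf\,Pg$, $f,g\in\mathcal F_n$ (the covariance matrix of $(\gamma_n(f))_{f\in\mathcal F_n}$), and let $\lambda_{1,k}$ be its smallest eigenvalue. Put $$\chi^2_{n,k}=\sup_{f}\Big\{(Q_0-P_n)f-\tfrac14P_nf^2\Big\}\in[0,+\infty],$$ the supremum being over the linear span of $\{1\}\cup\mathcal F_n$. **Theorem.** Suppose that $\mathcal F$ is $KMT(\delta_n;P)$ for some sequence $\delta_n\downarrow0$, that $\lambda_{1,k(n)}>0$ for all large $n$, and that, as $n\to\infty$, $$k(n)\to\infty,\qquad \lambda_{1,k}^{-1/2}\,k^{1/2}\,\delta_n\log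 n\to0,\qquad \lambda_{1,k}^{-1}\,k^{3/2}\,n^{-1/2}\to0 .$$ Then under $H_0:P\in\Omega$, $\chi^2_{n,k}$ is finite with probability tending to one, and $$\frac{n\chi^2_{n,k}-k}{\sqrt{2k}}\ \xrightarrow{\ d\ }\ N(0,1)$$ (where $\chi^2_{n,k}$ is replaced by $0$ on the event that it is infinite). -/

import Mathlib

open MeasureTheory ProbabilityTheory Filter Topology
open scoped ENNReal

noncomputable section

namespace ChiSquareSieve

variable {E : Type*} [MeasurableSpace E]

/-- The set `Ω` of signed measures `Q` of total mass one which integrate every `f ∈ 𝓕` and satisfy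
the linear constraints `∫ f dQ = a f` for `f ∈ 𝓕`. -/
def constraintSet (𝓕 : Set (E → ℝ)) (a : (E → ℝ) → ℝ) : Set (SignedMeasure E) :=
  {Q | Q Set.univ = 1 ∧ ∀ f ∈ 𝓕, Q.Integrable f ∧ ∫ᵛ x, f x ∂<•Q = a f}

/-- `P_n f`, the integral of `f` with respect to the empirical measure
`P_n = n⁻¹ ∑_{i < n} δ_{X i ω}` of the first `n` observations. -/
def empMean {Ω : Type*} (X : ℕ → Ω → E) (n : ℕ) (f : E → ℝ) (ω : Ω) : ℝ :=
  (n : ℝ)⁻¹ * ∑ i ∈ Finset.range n, f (X i ω)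

/-- The empirical process `γ_n(f) = √n (P_n - P) f`. -/
def gammaN {Ω : Type*} (X : ℕ → Ω → E) (P : Measure E) (n : ℕ) (f : E → ℝ) (ω : Ω) : ℝ :=
  √(n : ℝ) * (empMean X n f ω - ∫ x, f x ∂P)

/-- `B` is (a version of) the `P`-Brownian bridge indexed by the class `𝓕 ⊆ L²(P)`: the centered
Gaussian process with covariance function `(f, g) ↦ P (f g) - P f * P g`. -/
structure IsBrownianBridge {Ω : Type*} [MeasurableSpace Ω] (P : Measure E) (𝓕 : Set (E → ℝ))
    (B : 𝓕 → Ω → ℝ) (μ : Measure Ω) : Prop where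
  memLp : ∀ f ∈ 𝓕, MemLp f 2 P
  gaussian : IsGaussianProcess B μ
  mean_zero : ∀ f : 𝓕, ∫ ω, B f ω ∂μ = 0
  covariance_eq : ∀ f g : 𝓕, cov[B f, B g; μ] = cov[(f : E → ℝ), (g : E → ℝ); P]

/-- The pseudometric `ρ_P(f, g) = Var_P(f - g)^{1/2}`. -/
def rhoDist (P : Measure E) (f g : E → ℝ) : ℝ := √(Var[f - g; P])

/-- `𝓕` is `P`-pregaussian: on some probability space there is a `P`-Brownian bridge indexed by `𝓕`
almost all of whose sample paths are bounded on `𝓕` (that is, belong to `ℓ^∞(𝓕)`) and uniformly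
continuous with respect to `ρ_P`. -/
def IsPregaussian (P : Measure E) (𝓕 : Set (E → ℝ)) : Prop :=
  ∃ (Ω : Type) (_ : MeasurableSpace Ω) (μ : Measure Ω) (B : 𝓕 → Ω → ℝ),
    IsProbabilityMeasure μ ∧ IsBrownianBridge P 𝓕 B μ ∧
    ∀ᵐ ω ∂μ, (∃ C : ℝ, ∀ f : 𝓕, |B f ω| ≤ C) ∧
      ∀ ε > 0, ∃ η > 0, ∀ f g : 𝓕, rhoDist P f g < η → |B f ω - B g ω| < ε

/-- `𝓕` is a Komlós-Major-Tusnády class with respect to `P` with rate `δ`, `𝓕 ∈ KMT(δ_n; P)`: it is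
pregaussian and, on some probability space, there are an i.i.d. sequence `X` with law `P`,
`P`-Brownian bridges `B n`, and constants `b, c, θ > 0` such that for all `n ≥ 1` and `t > 0`
`Pr {sup_{f ∈ 𝓕} |√n (P_n - P) f - B_n f| ≥ δ_n (t + b log n)} ≤ c exp (-θ t)`.
The supremum is taken in `[0, ∞]`. -/
def IsKMT (δ : ℕ → ℝ) (P : Measure E) (𝓕 : Set (E → ℝ)) : Prop :=
  IsPregaussian P 𝓕 ∧
  ∃ (Ω : Type) (_ : MeasurableSpace Ω) (μ : Measure Ω) (X : ℕ → Ω → E) (B : ℕ → 𝓕 → Ω → ℝ)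
    (b c θ : ℝ),
    IsProbabilityMeasure μ ∧ (∀ i, HasLaw (X i) P μ) ∧ iIndepFun X μ ∧
    (∀ n, 1 ≤ n → IsBrownianBridge P 𝓕 (B n) μ) ∧
    0 < b ∧ 0 < c ∧ 0 < θ ∧
    ∀ n : ℕ, 1 ≤ n → ∀ t : ℝ, 0 < t →
      μ {ω | ENNReal.ofReal (δ n * (t + b * Real.log n)) ≤
          ⨆ f : 𝓕, ENNReal.ofReal |gammaN X P n f ω - B n f ω|} ≤
        ENNReal.ofReal (c * Real.exp (-θ * t))

/-- The covariance matrix `S_k` of the random vector `(γ_n(f))_{f ∈ G}`, `k = card G`, with entries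
`P (f g) - P f * P g`. -/
def covMatrix (P : Measure E) (G : Finset (E → ℝ)) : Matrix G G ℝ :=
  Matrix.of fun f g => cov[(f : E → ℝ), (g : E → ℝ); P]

open scoped Classical in
/-- The smallest eigenvalue `λ_{1,k}` of the (symmetric) covariance matrix `S_k`. -/
def minEigenvalue (P : Measure E) (G : Finset (E → ℝ)) : ℝ :=
  sInf (spectrum ℝ (covMatrix P G))

/-- The estimator `χ²_{n,k} = sup_f (Q₀ - P_n) f - (1/4) P_n f²`, the supremum running over the
linear span of the constant function `1` and of the functions of `G = 𝓕_n`; it is taken in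
`[-∞, +∞]`. -/
def chiSq {Ω : Type*} (Q₀ : SignedMeasure E) (X : ℕ → Ω → E) (n : ℕ) (G : Finset (E → ℝ))
    (ω : Ω) : EReal :=
  ⨆ f ∈ Submodule.span ℝ (insert 1 (G : Set (E → ℝ))),
    ((∫ᵛ x, f x ∂<•Q₀ - empMean X n f ω - 1 / 4 * empMean X n (f ^ 2) ω : ℝ) : EReal)

/-- The standardized statistic `(n χ²_{n,k} - k) / √(2 k)` with `k = card G`. -/
def standardizedChiSq {Ω : Type*} (Q₀ : SignedMeasure E) (X : ℕ → Ω → E) (n : ℕ)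
    (G : Finset (E → ℝ)) (ω : Ω) : ℝ :=
  (n * (chiSq Q₀ X n G ω).toReal - G.card) / √(2 * G.card)

end ChiSquareSieve

end

/-!
The estimator is a quadratic programme. Every constraint has the same value under `Q₀` and under
`P`, so on the span of `1` and of the `k` functions of the sieve `(Q₀ - P_n) f` equals
`-(P_n - P) f`; the constant function is optimised away by centring (`chiSq_eq_iSup`), which turns
`P_n f²` into the empirical variance. After a rescaling, `n χ²_{n,k}` is
`sup_d (2 d ⬝ γ - q̂ d)`, where `γ` is the vector of the values of the empirical process and `q̂` is
the form of the empirical covariance matrix. If `q̂` has relative distance at most `ε < 1` from the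
form of the covariance matrix `S`, this supremum is finite and lies within a factor `(1 ± ε)⁻¹` of
`|A γ|² = γᵀ S⁻¹ γ`, where `A S Aᵀ = 1` (`two_mul_dotProduct_sub_le`,
`exists_le_two_mul_dotProduct_sub`).

Two approximations remain, each of them `o(√k)` in probability.

* From `q̂` to `S`: the relative error is at most `λ⁻¹` times the Frobenius distance of the two
  matrices, which is of order `k n^{-1/2}`, so the replacement costs `λ⁻¹ k n^{-1/2} k`. This needs
  fourth moments bounded uniformly over the class although the envelope need not be integrable; they
  come from the `KMT` inequality for `n = 1` and from the bounded variances of a pregaussian class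
  (`IsKMT.exists_integral_pow_four_le`, `IsPregaussian.exists_variance_le`).
* From `γ` to the Brownian bridge: the `KMT` inequality with `t = log n` bounds the distance of the
  whitened vectors by a multiple of `λ^{-1/2} k^{1/2} δ_n log n`.

The whitened bridge is a standard Gaussian vector of dimension `k` (`IsBrownianBridge.whiten`), so
its squared length has the `χ²_k` law, and the central limit theorem for the squares, together with
Slutsky's lemma, finishes the proof on the probability space of the bridges
(`tendsto_on_strong_approximation_space`). The statistic is a measurable function of the sample, so
the conclusion carries over to every probability space with an i.i.d. sample (`hasLaw_sample`).
-/

noncomputable section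

namespace ChiSquareSieve

open Matrix

/-! ### Whitening and quadratic programmes -/

section LinearAlgebra

variable {ι : Type*} [Fintype ι]

open scoped MatrixOrder in
/-- A positive definite matrix can be whitened: if `S = Bᵀ B`, take `A = (Bᵀ)⁻¹`. -/
lemma exists_conj_transpose_eq_one [DecidableEq ι] {S : Matrix ι ι ℝ} (hS : S.PosDef) :
    ∃ A : Matrix ι ι ℝ, A * S * Aᵀ = 1 := by
  obtain ⟨B, hB⟩ := CStarAlgebra.nonneg_iff_eq_star_mul_self.mp hS.posSemidef.nonneg
  have hB' : S = Bᵀ * B := by simpa [star_eq_conjTranspose] using hB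
  have hdet : IsUnit B.det := by
    have h := hS.isUnit
    rw [isUnit_iff_isUnit_det, hB', det_mul, det_transpose] at h
    exact isUnit_of_mul_isUnit_left h
  refine ⟨(Bᵀ)⁻¹, ?_⟩
  have hdet' : IsUnit (Bᵀ).det := by rwa [det_transpose]
  rw [hB', transpose_nonsing_inv, transpose_transpose, ← Matrix.mul_assoc,
    nonsing_inv_mul _ hdet', Matrix.one_mul, mul_nonsing_inv _ hdet]

lemma sInf_spectrum_mul_dotProduct_le [DecidableEq ι] {S : Matrix ι ι ℝ} (hS : S.IsHermitian)
    (d : ι → ℝ) : sInf (spectrum ℝ S) * (d ⬝ᵥ d) ≤ d ⬝ᵥ S *ᵥ d := by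
  have h : (S - algebraMap ℝ _ (sInf (spectrum ℝ S))).PosSemidef := by
    refine posSemidef_iff_isHermitian_and_spectrum_nonneg.2 ⟨?_, fun a ha => ?_⟩
    · refine hS.sub ?_
      rw [algebraMap_eq_diagonal]
      exact isHermitian_diagonal _
    · rw [← spectrum.sub_singleton_eq] at ha
      obtain ⟨b, hb, c, hc, rfl⟩ := Set.mem_sub.1 ha
      rw [Set.mem_singleton_iff] at hc
      simpa [hc] using csInf_le finite_real_spectrum.bddBelow hb
  have h' := h.dotProduct_mulVec_nonneg d
  simp only [star_trivial, sub_mulVec, dotProduct_sub, sub_nonneg] at h'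
  rwa [Algebra.algebraMap_eq_smul_one, smul_mulVec, one_mulVec, dotProduct_smul, smul_eq_mul]
    at h'

lemma posDef_of_sInf_spectrum_pos [DecidableEq ι] {S : Matrix ι ι ℝ} (hS : S.IsHermitian)
    (h : 0 < sInf (spectrum ℝ S)) : S.PosDef := by
  refine posDef_iff_dotProduct_mulVec.2 ⟨hS, fun d hd => ?_⟩
  rw [star_trivial]
  refine lt_of_lt_of_le (mul_pos h ?_) (sInf_spectrum_mul_dotProduct_le hS d)
  simpa using dotProduct_star_self_pos_iff.2 hd

/-- If `l` bounds the Rayleigh quotient of `S` from below, a whitening matrix `A` of `S` has operator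
norm at most `l^{-1/2}`: its transpose satisfies `l |Aᵀ u|² ≤ |u|²`, and the norms of `A` and `Aᵀ`
agree by Cauchy-Schwarz. -/
lemma mulVec_dotProduct_self_le [DecidableEq ι] {S A : Matrix ι ι ℝ} {l : ℝ} (hl : 0 < l)
    (hS : ∀ d : ι → ℝ, l * (d ⬝ᵥ d) ≤ d ⬝ᵥ S *ᵥ d) (hA : A * S * Aᵀ = 1) (w : ι → ℝ) :
    (A *ᵥ w) ⬝ᵥ (A *ᵥ w) ≤ l⁻¹ * (w ⬝ᵥ w) := by
  set u := A *ᵥ w with hu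
  set d := Aᵀ *ᵥ u with hd
  have h1 : d ⬝ᵥ S *ᵥ d = u ⬝ᵥ u := by
    rw [hd, dotProduct_comm, mulVec_mulVec, dotProduct_mulVec, vecMul_transpose, mulVec_mulVec,
      ← Matrix.mul_assoc, hA, one_mulVec]
  have h2 : u ⬝ᵥ u = w ⬝ᵥ d := by
    rw [hd, mulVec_transpose, dotProduct_comm w, ← dotProduct_mulVec]
  have h3 : (w ⬝ᵥ d) ^ 2 ≤ (w ⬝ᵥ w) * (d ⬝ᵥ d) := by
    simpa [dotProduct, sq] using Finset.sum_mul_sq_le_sq_mul_sq Finset.univ w d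
  have h4 := hS d
  rw [h1] at h4
  have h5 : 0 ≤ w ⬝ᵥ w := by simpa using dotProduct_star_self_nonneg w
  have h6 : 0 ≤ u ⬝ᵥ u := by simpa using dotProduct_star_self_nonneg u
  rw [← h2] at h3
  rw [inv_mul_eq_div, le_div_iff₀ hl]
  by_contra! hlt
  have h7 : 0 < u ⬝ᵥ u := by
    rcases h6.eq_or_lt with h | h
    · rw [← h] at hlt; linarith
    · exact h
  nlinarith

/-- The value of the quadratic programme `sup_d (2 d ⬝ γ - q' d)` decreases in `q'`, and it is
`s⁻¹ γᵀ S⁻¹ γ = s⁻¹ |A γ|²` for the form `s S`. Hence `q' ≥ (1 - ε) S` gives this upper bound. -/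
lemma two_mul_dotProduct_sub_le [DecidableEq ι] {S A : Matrix ι ι ℝ} (hA : A * S * Aᵀ = 1)
    (γ : ι → ℝ) {q' : (ι → ℝ) → ℝ} {ε : ℝ} (hε : ε < 1)
    (hq : ∀ d, |q' d - d ⬝ᵥ S *ᵥ d| ≤ ε * (d ⬝ᵥ S *ᵥ d)) (d : ι → ℝ) :
    2 * (d ⬝ᵥ γ) - q' d ≤ (A *ᵥ γ) ⬝ᵥ (A *ᵥ γ) / (1 - ε) := by
  have hdet : IsUnit (Aᵀ).det := by
    have : IsUnit (A * S * Aᵀ) := by rw [hA]; exact isUnit_one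
    rw [isUnit_iff_isUnit_det, det_mul] at this
    exact isUnit_of_mul_isUnit_right this
  obtain ⟨c, rfl⟩ : ∃ c, Aᵀ *ᵥ c = d :=
    ⟨(Aᵀ)⁻¹ *ᵥ d, by rw [mulVec_mulVec, mul_nonsing_inv _ hdet, one_mulVec]⟩
  have h1 : (Aᵀ *ᵥ c) ⬝ᵥ S *ᵥ (Aᵀ *ᵥ c) = c ⬝ᵥ c := by
    rw [dotProduct_comm, mulVec_mulVec, dotProduct_mulVec, vecMul_transpose, mulVec_mulVec,
      ← Matrix.mul_assoc, hA, one_mulVec]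
  have h2 : (Aᵀ *ᵥ c) ⬝ᵥ γ = c ⬝ᵥ (A *ᵥ γ) := by
    rw [dotProduct_comm, dotProduct_mulVec, vecMul_transpose, dotProduct_comm]
  have h3 := (abs_le.1 (hq (Aᵀ *ᵥ c))).1
  rw [h1] at h3
  rw [h2]
  set u := A *ᵥ γ
  have h4 : 0 ≤ ((1 - ε) • c - u) ⬝ᵥ ((1 - ε) • c - u) := by
    simpa using dotProduct_star_self_nonneg ((1 - ε) • c - u)
  simp only [sub_dotProduct, dotProduct_sub, smul_dotProduct, dotProduct_smul, smul_eq_mul] at h4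
  rw [dotProduct_comm u c] at h4
  rw [le_div_iff₀ (by linarith)]
  nlinarith

/-- The lower bound for the same programme, at the maximiser `(1 + ε)⁻¹ S⁻¹ γ` of the form
`(1 + ε) S ≥ q'`. -/
lemma exists_le_two_mul_dotProduct_sub [DecidableEq ι] {S A : Matrix ι ι ℝ}
    (hA : A * S * Aᵀ = 1)
    (γ : ι → ℝ) {q' : (ι → ℝ) → ℝ} {ε : ℝ} (hε : 0 ≤ ε)
    (hq : ∀ d, |q' d - d ⬝ᵥ S *ᵥ d| ≤ ε * (d ⬝ᵥ S *ᵥ d)) :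
    ∃ d, (A *ᵥ γ) ⬝ᵥ (A *ᵥ γ) / (1 + ε) ≤ 2 * (d ⬝ᵥ γ) - q' d := by
  set u := A *ᵥ γ with hu
  set c := (1 + ε)⁻¹ • u with hc
  refine ⟨Aᵀ *ᵥ c, ?_⟩
  have h1 : (Aᵀ *ᵥ c) ⬝ᵥ S *ᵥ (Aᵀ *ᵥ c) = c ⬝ᵥ c := by
    rw [dotProduct_comm, mulVec_mulVec, dotProduct_mulVec, vecMul_transpose, mulVec_mulVec,
      ← Matrix.mul_assoc, hA, one_mulVec]
  have h2 : (Aᵀ *ᵥ c) ⬝ᵥ γ = c ⬝ᵥ u := by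
    rw [dotProduct_comm, dotProduct_mulVec, vecMul_transpose, dotProduct_comm]
  have h3 := (abs_le.1 (hq (Aᵀ *ᵥ c))).2
  rw [h1] at h3
  rw [h2]
  have h4 : u ⬝ᵥ u / (1 + ε) = 2 * (c ⬝ᵥ u) - (1 + ε) * (c ⬝ᵥ c) := by
    simp only [hc, smul_dotProduct, dotProduct_smul, smul_eq_mul]
    field_simp
    ring
  rw [h4]
  linarith

/-- Cauchy-Schwarz for a bilinear form and its Frobenius norm. -/
lemma abs_sum_mul_mul_le (M : ι → ι → ℝ) (d : ι → ℝ) :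
    |∑ i, ∑ j, d i * d j * M i j| ≤ √(∑ i, ∑ j, M i j ^ 2) * (d ⬝ᵥ d) := by
  have h0 : 0 ≤ d ⬝ᵥ d := by simpa using dotProduct_star_self_nonneg d
  have h := Finset.sum_mul_sq_le_sq_mul_sq (Finset.univ : Finset (ι × ι))
    (fun p => M p.1 p.2) (fun p => d p.1 * d p.2)
  rw [Fintype.sum_prod_type, Fintype.sum_prod_type, Fintype.sum_prod_type] at h
  have h1 : ∑ i, ∑ j, (d i * d j) ^ 2 = (d ⬝ᵥ d) ^ 2 := by
    rw [sq (d ⬝ᵥ d), dotProduct, Finset.sum_mul_sum]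
    exact Finset.sum_congr rfl fun i _ => Finset.sum_congr rfl fun j _ => by ring
  simp only [h1] at h
  rw [← Real.sqrt_sq h0, ← Real.sqrt_mul (by positivity), ← Real.sqrt_sq_eq_abs]
  refine Real.sqrt_le_sqrt (le_trans (le_of_eq ?_) h)
  congr 1
  exact Finset.sum_congr rfl fun i _ => Finset.sum_congr rfl fun j _ => by ring

lemma abs_dotProduct_self_sub_le (a b : ι → ℝ) {r z : ℝ} (hr : 0 ≤ r) (hz : 0 ≤ z)
    (h1 : (a - b) ⬝ᵥ (a - b) ≤ r ^ 2) (h2 : b ⬝ᵥ b ≤ z ^ 2) :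
    |a ⬝ᵥ a - b ⬝ᵥ b| ≤ r * (2 * z + r) := by
  have h3 : a ⬝ᵥ a - b ⬝ᵥ b = (a - b) ⬝ᵥ (a - b) + 2 * ((a - b) ⬝ᵥ b) := by
    simp only [sub_dotProduct, dotProduct_sub]
    rw [dotProduct_comm b a]; ring
  have h4 : ((a - b) ⬝ᵥ b) ^ 2 ≤ ((a - b) ⬝ᵥ (a - b)) * (b ⬝ᵥ b) := by
    simpa [dotProduct, sq] using Finset.sum_mul_sq_le_sq_mul_sq Finset.univ (a - b) b
  have h5 : 0 ≤ (a - b) ⬝ᵥ (a - b) := by simpa using dotProduct_star_self_nonneg (a - b)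
  have h6 : 0 ≤ b ⬝ᵥ b := by simpa using dotProduct_star_self_nonneg b
  have h7 : |(a - b) ⬝ᵥ b| ≤ r * z := by
    refine abs_le_of_sq_le_sq (h4.trans ?_) (by positivity)
    rw [mul_pow]
    exact mul_le_mul h1 h2 h6 (by positivity)
  rw [h3]
  refine (abs_add_le _ _).trans ?_
  rw [abs_of_nonneg h5, abs_mul, abs_two]
  nlinarith

end LinearAlgebra

/-! ### Reduction of the estimator to a quadratic programme -/

section Reduction

variable {E : Type*} {Ω : Type*}

lemma empMean_add (X : ℕ → Ω → E) (n : ℕ) (f g : E → ℝ) (ω : Ω) :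
    empMean X n (f + g) ω = empMean X n f ω + empMean X n g ω := by
  simp [empMean, Finset.sum_add_distrib, mul_add]

lemma empMean_smul (X : ℕ → Ω → E) (n : ℕ) (c : ℝ) (f : E → ℝ) (ω : Ω) :
    empMean X n (c • f) ω = c * empMean X n f ω := by
  simp only [empMean, Pi.smul_apply, smul_eq_mul, ← Finset.mul_sum]
  ring

lemma empMean_sum (X : ℕ → Ω → E) (n : ℕ) {κ : Type*} (s : Finset κ) (f : κ → E → ℝ) (ω : Ω) :
    empMean X n (∑ i ∈ s, f i) ω = ∑ i ∈ s, empMean X n (f i) ω := by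
  simp only [empMean, Finset.sum_apply]
  rw [Finset.sum_comm, Finset.mul_sum]

lemma empMean_one (X : ℕ → Ω → E) {n : ℕ} (hn : 1 ≤ n) (ω : Ω) :
    empMean X n (1 : E → ℝ) ω = 1 := by
  have : (n : ℝ) ≠ 0 := by positivity
  simp [empMean, this]

/-- The linear combination of the functions of `G` with coefficients `d`. -/
def linComb {G : Finset (E → ℝ)} (d : G → ℝ) : E → ℝ := ∑ f, d f • (f : E → ℝ)

/-- The empirical variance of the linear combination with coefficients `d`, a quadratic form
in `d`. -/
def empVar (X : ℕ → Ω → E) (n : ℕ) {G : Finset (E → ℝ)} (ω : Ω) (d : G → ℝ) : ℝ :=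
  empMean X n (linComb d ^ 2) ω - empMean X n (linComb d) ω ^ 2

lemma empMean_linComb (X : ℕ → Ω → E) (n : ℕ) {G : Finset (E → ℝ)} (d : G → ℝ) (ω : Ω) :
    empMean X n (linComb d) ω = ∑ f, d f * empMean X n f ω := by
  rw [linComb, empMean_sum]
  simp only [empMean_smul]

lemma exists_eq_smul_add_linComb {G : Finset (E → ℝ)} {f : E → ℝ}
    (hf : f ∈ Submodule.span ℝ (insert 1 (G : Set (E → ℝ)))) :
    ∃ (c : ℝ) (d : G → ℝ), f = c • (1 : E → ℝ) + linComb d := by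
  obtain ⟨c, z, hz, rfl⟩ := Submodule.mem_span_insert.1 hf
  obtain ⟨d, -, rfl⟩ := Submodule.mem_span_finset.1 hz
  refine ⟨c, fun f => d f, ?_⟩
  rw [linComb, Finset.sum_coe_sort G (fun f => d f • f)]

lemma smul_add_linComb_mem {G : Finset (E → ℝ)} (c : ℝ) (d : G → ℝ) :
    c • (1 : E → ℝ) + linComb d ∈ Submodule.span ℝ (insert 1 (G : Set (E → ℝ))) := by
  refine add_mem (Submodule.smul_mem _ _ (Submodule.subset_span (Set.mem_insert _ _)))
    (Submodule.sum_mem _ fun f _ => Submodule.smul_mem _ _ (Submodule.subset_span ?_))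
  exact Set.mem_insert_of_mem _ f.2

/-- The empirical second moment splits into the empirical variance and the square of the empirical
mean; only the latter depends on the coefficient `c` of the constant function. -/
lemma empMean_sq_eq (X : ℕ → Ω → E) {n : ℕ} (hn : 1 ≤ n) {G : Finset (E → ℝ)} (c : ℝ) (d : G → ℝ)
    (ω : Ω) : empMean X n ((c • (1 : E → ℝ) + linComb d) ^ 2) ω =
      empVar X n ω d + (c + empMean X n (linComb d) ω) ^ 2 := by
  have h : (c • (1 : E → ℝ) + linComb d) ^ 2 =
      (c ^ 2) • (1 : E → ℝ) + (2 * c) • linComb d + linComb d ^ 2 := by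
    ext x
    simp only [Pi.pow_apply, Pi.add_apply, Pi.smul_apply, Pi.one_apply, smul_eq_mul]
    ring
  rw [h, empMean_add, empMean_add, empMean_smul, empMean_smul, empMean_one X hn, empVar]
  ring

lemma empVar_eq_sum (X : ℕ → Ω → E) (n : ℕ) {G : Finset (E → ℝ)} (ω : Ω) (d : G → ℝ) :
    empVar X n ω d = ∑ f, ∑ g, d f * d g *
      (empMean X n (f * g : E → ℝ) ω - empMean X n f ω * empMean X n g ω) := by
  have h : linComb d ^ 2 = ∑ f, ∑ g, (d f * d g) • ((f : E → ℝ) * g) := by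
    rw [linComb, sq, Finset.sum_mul_sum]
    refine Finset.sum_congr rfl fun f _ => Finset.sum_congr rfl fun g _ => ?_
    rw [smul_mul_smul_comm]
  rw [empVar, h, empMean_sum, empMean_linComb, sq, Finset.sum_mul_sum, ← Finset.sum_sub_distrib]
  refine Finset.sum_congr rfl fun f _ => ?_
  rw [empMean_sum, ← Finset.sum_sub_distrib]
  refine Finset.sum_congr rfl fun g _ => ?_
  rw [empMean_smul]
  ring

lemma empVar_smul (X : ℕ → Ω → E) (n : ℕ) {G : Finset (E → ℝ)} (ω : Ω) (c : ℝ) (d : G → ℝ) :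
    empVar X n ω (c • d) = c ^ 2 * empVar X n ω d := by
  rw [empVar_eq_sum, empVar_eq_sum, Finset.mul_sum]
  refine Finset.sum_congr rfl fun f _ => ?_
  rw [Finset.mul_sum]
  refine Finset.sum_congr rfl fun g _ => ?_
  simp only [Pi.smul_apply, smul_eq_mul]
  ring

variable [MeasurableSpace E]

lemma isFiniteMeasure_variation (Q : SignedMeasure E) : IsFiniteMeasure Q.variation := by
  rw [← SignedMeasure.totalVariation_eq_variation]
  infer_instance

lemma integral_smul_one_add_linComb {Q : SignedMeasure E} (hQ : Q Set.univ = 1)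
    {G : Finset (E → ℝ)} {a : (E → ℝ) → ℝ} (hG : ∀ f ∈ G, Q.Integrable f ∧ ∫ᵛ x, f x ∂<•Q = a f)
    (c : ℝ) (d : G → ℝ) :
    ∫ᵛ x, (c • (1 : E → ℝ) + linComb d) x ∂<•Q = c + ∑ f, d f * a f := by
  have := isFiniteMeasure_variation Q
  have h1 : Q.Integrable (c • (1 : E → ℝ)) := (integrable_const (1 : ℝ)).smul c
  have h2 : ∀ f ∈ Finset.univ, Q.Integrable (d f • (f : E → ℝ)) :=
    fun f _ => VectorMeasure.Integrable.smul _ (hG f f.2).1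
  have h3 : Q.Integrable (linComb d) := VectorMeasure.Integrable.finsetSum _ h2
  have e1 : ∫ᵛ x, (c • (1 : E → ℝ) + linComb d) x ∂<•Q =
      ∫ᵛ x, (c • (1 : E → ℝ)) x ∂<•Q + ∫ᵛ x, (linComb d) x ∂<•Q :=
    VectorMeasure.integral_add h1 h3
  have e2 : ∫ᵛ x, (c • (1 : E → ℝ)) x ∂<•Q = c := by
    have : ∫ᵛ _, c ∂<•Q = c * Q Set.univ := by
      rw [VectorMeasure.integral_const]; simp [mul_comm]
    rw [hQ, mul_one] at this
    simpa using this
  have e3 : ∫ᵛ x, (linComb d) x ∂<•Q = ∑ f, d f * a f := by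
    have : ∫ᵛ x, (linComb d) x ∂<•Q = ∑ f : G, ∫ᵛ x, (d f • (f : E → ℝ)) x ∂<•Q := by
      have := VectorMeasure.integral_finsetSum (μ := Q) (B := (ContinuousLinearMap.lsmul ℝ ℝ).flip)
        Finset.univ h2
      rw [← this, linComb]
      simp
    rw [this]
    refine Finset.sum_congr rfl fun f _ => ?_
    have := VectorMeasure.integral_smul (μ := Q) (B := (ContinuousLinearMap.lsmul ℝ ℝ).flip)
      (f := (f : E → ℝ)) (d f)
    exact this.trans (by rw [(hG f f.2).2, smul_eq_mul])
  rw [e1, e2, e3]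

/-- The coefficient of the constant function is eliminated by centring: the estimator is the
supremum of a linear minus a quadratic form in the remaining coefficients. -/
lemma chiSq_eq_iSup {Q : SignedMeasure E} (hQ : Q Set.univ = 1)
    {G : Finset (E → ℝ)} {a : (E → ℝ) → ℝ} (hG : ∀ f ∈ G, Q.Integrable f ∧ ∫ᵛ x, f x ∂<•Q = a f)
    (X : ℕ → Ω → E) {n : ℕ} (hn : 1 ≤ n) (ω : Ω) :
    chiSq Q X n G ω = ⨆ d : G → ℝ,
      ((-(∑ f, d f * (empMean X n f ω - a f)) - 1 / 4 * empVar X n ω d : ℝ) : EReal) := by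
  have key : ∀ (c : ℝ) (d : G → ℝ),
      ∫ᵛ x, (c • (1 : E → ℝ) + linComb d) x ∂<•Q - empMean X n (c • (1 : E → ℝ) + linComb d) ω
        - 1 / 4 * empMean X n ((c • (1 : E → ℝ) + linComb d) ^ 2) ω
      = -(∑ f, d f * (empMean X n f ω - a f)) - 1 / 4 * empVar X n ω d
        - 1 / 4 * (c + empMean X n (linComb d) ω) ^ 2 := by
    intro c d
    rw [integral_smul_one_add_linComb hQ hG, empMean_sq_eq X hn, empMean_add, empMean_smul,
      empMean_one X hn, empMean_linComb]
    simp only [mul_sub, Finset.sum_sub_distrib]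
    ring
  apply le_antisymm
  · refine iSup₂_le fun f hf => ?_
    obtain ⟨c, d, rfl⟩ := exists_eq_smul_add_linComb hf
    refine le_iSup_of_le d ?_
    rw [EReal.coe_le_coe_iff, key]
    have := sq_nonneg (c + empMean X n (linComb d) ω)
    linarith
  · refine iSup_le fun d => ?_
    -- the best coefficient of the constant function centres the linear combination
    refine le_iSup₂_of_le (-(empMean X n (linComb d) ω) • (1 : E → ℝ) + linComb d)
      (smul_add_linComb_mem _ d) ?_
    rw [EReal.coe_le_coe_iff, key]
    simp

/-- The supremum defining the estimator runs over a separable set of coefficients, so the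
estimator is a measurable function of the sample. -/
lemma measurable_chiSq [MeasurableSpace Ω] {Q : SignedMeasure E} (hQ : Q Set.univ = 1)
    {G : Finset (E → ℝ)} {a : (E → ℝ) → ℝ} (hG : ∀ f ∈ G, Q.Integrable f ∧ ∫ᵛ x, f x ∂<•Q = a f)
    (hGm : ∀ f ∈ G, Measurable f) {X : ℕ → Ω → E} (hX : ∀ i, Measurable (X i)) {n : ℕ}
    (hn : 1 ≤ n) : Measurable (chiSq Q X n G) := by
  have hemp : ∀ f : E → ℝ, Measurable f → Measurable (empMean X n f) := fun f hf => by
    unfold empMean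
    fun_prop
  obtain ⟨s, hsc, hsd⟩ := TopologicalSpace.exists_countable_dense (G → ℝ)
  have : chiSq Q X n G = fun ω => ⨆ d : s,
      ((-(∑ f, d.1 f * (empMean X n f ω - a f)) - 1 / 4 * empVar X n ω d.1 : ℝ) : EReal) := by
    ext1 ω
    rw [chiSq_eq_iSup hQ hG X hn]
    refine (hsd.ciSup' (f := fun d : G → ℝ =>
      ((-(∑ f, d f * (empMean X n f ω - a f)) - 1 / 4 * empVar X n ω d : ℝ) : EReal)) ?_).symm
    refine continuous_coe_real_ereal.comp ?_
    simp only [empVar_eq_sum]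
    fun_prop
  rw [this]
  have := hsc.to_subtype
  refine Measurable.iSup fun d => measurable_coe_real_ereal.comp ?_
  simp only [empVar_eq_sum]
  have h1 : ∀ f : G, Measurable (empMean X n (f : E → ℝ)) := fun f => hemp _ (hGm f f.2)
  have h2 : ∀ f g : G, Measurable (empMean X n ((f : E → ℝ) * g)) :=
    fun f g => hemp _ ((hGm f f.2).mul (hGm g g.2))
  fun_prop

/-- If the empirical variance is uniformly close to the variance, `n χ²_{n,k}` is close to the
quadratic form `γᵀ S⁻¹ γ = |A γ|²` of the empirical process. -/
lemma chiSq_ne_top_and_abs_sub_le {Q : SignedMeasure E} (hQ : Q Set.univ = 1) {P : Measure E}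
    {G : Finset (E → ℝ)} (hG : ∀ f ∈ G, Q.Integrable f ∧ ∫ᵛ x, f x ∂<•Q = ∫ x, f x ∂P)
    (X : ℕ → Ω → E) {n : ℕ} (hn : 1 ≤ n) (ω : Ω) [DecidableEq G] {S A : Matrix G G ℝ}
    (hA : A * S * Aᵀ = 1) {ε : ℝ} (hε0 : 0 ≤ ε) (hε : ε ≤ 1 / 2)
    (hq : ∀ d, |empVar X n ω d - d ⬝ᵥ S *ᵥ d| ≤ ε * (d ⬝ᵥ S *ᵥ d)) {T : ℝ}
    (hT : T = (A *ᵥ fun f : G => gammaN X P n f ω) ⬝ᵥ (A *ᵥ fun f : G => gammaN X P n f ω)) :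
    chiSq Q X n G ω ≠ ⊤ ∧ |n * (chiSq Q X n G ω).toReal - T| ≤ 2 * ε * T := by
  have hn0 : (0 : ℝ) < n := by positivity
  set γ : G → ℝ := fun f => gammaN X P n f ω with hγ
  -- the substitution `d ↦ -2 n^{-1/2} d` brings the quadratic programme to its standard form
  have hsub : ∀ d : G → ℝ, n * (-(∑ f, ((-2 / √n) • d) f * (empMean X n f ω - ∫ x, f.1 x ∂P))
      - 1 / 4 * empVar X n ω ((-2 / √n) • d)) = 2 * (d ⬝ᵥ γ) - empVar X n ω d := by
    intro d
    have hs : √(n : ℝ) * √(n : ℝ) = n := Real.mul_self_sqrt hn0.le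
    have hs0 : √(n : ℝ) ≠ 0 := (Real.sqrt_pos.2 hn0).ne'
    have e1 : (n : ℝ) * (1 / 4 * ((-2 / √n) ^ 2 * empVar X n ω d)) = empVar X n ω d := by
      rw [div_pow, Real.sq_sqrt hn0.le]; field_simp; ring
    have e2 : (n : ℝ) * -(∑ f, ((-2 / √n) • d) f * (empMean X n f ω - ∫ x, f.1 x ∂P))
        = 2 * (d ⬝ᵥ γ) := by
      simp only [dotProduct, hγ, gammaN, Pi.smul_apply, smul_eq_mul]
      rw [mul_neg, Finset.mul_sum, Finset.mul_sum, ← Finset.sum_neg_distrib]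
      refine Finset.sum_congr rfl fun f _ => ?_
      field_simp
      linear_combination (-1 * (d f * (empMean X n f ω - ∫ x, f.1 x ∂P))) * hs
    rw [empVar_smul, mul_sub, e1, e2]
  have hT0 : 0 ≤ T := by rw [hT]; simpa using dotProduct_star_self_nonneg (A *ᵥ γ)
  have hsup := chiSq_eq_iSup hQ hG X hn ω
  have hup : chiSq Q X n G ω ≤ ((T / (1 - ε) / n : ℝ) : EReal) := by
    rw [hsup]
    refine iSup_le fun d => ?_
    rw [EReal.coe_le_coe_iff, le_div_iff₀ hn0, mul_comm]
    have h := two_mul_dotProduct_sub_le hA γ (by linarith) hq ((-√n / 2) • d)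
    rw [← hsub, ← hT, smul_smul] at h
    have : -2 / √(n : ℝ) * (-√n / 2) = 1 := by
      have hs0 : √(n : ℝ) ≠ 0 := (Real.sqrt_pos.2 hn0).ne'
      field_simp
    rwa [this, one_smul] at h
  have hlow : ((T / (1 + ε) / n : ℝ) : EReal) ≤ chiSq Q X n G ω := by
    obtain ⟨d, hd⟩ := exists_le_two_mul_dotProduct_sub hA γ hε0 hq
    rw [hsup]
    refine le_iSup_of_le ((-2 / √n) • d) ?_
    rw [EReal.coe_le_coe_iff, div_le_iff₀ hn0, mul_comm, hsub, hT]
    exact hd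
  have hne : chiSq Q X n G ω ≠ ⊤ := (hup.trans_lt (EReal.coe_lt_top _)).ne
  have hne' : chiSq Q X n G ω ≠ ⊥ := ((EReal.bot_lt_coe _).trans_le hlow).ne'
  refine ⟨hne, ?_⟩
  lift chiSq Q X n G ω to ℝ using ⟨hne, hne'⟩ with y
  rw [EReal.coe_le_coe_iff] at hup hlow
  rw [EReal.toReal_coe]
  rw [le_div_iff₀ hn0] at hup
  rw [div_le_iff₀ hn0] at hlow
  have h1 : T / (1 - ε) ≤ T + 2 * ε * T := by
    rw [div_le_iff₀ (by linarith)]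
    have : 0 ≤ T * ε * (1 - 2 * ε) := by
      apply mul_nonneg (mul_nonneg hT0 hε0); linarith
    nlinarith
  have h2 : T - 2 * ε * T ≤ T / (1 + ε) := by
    rw [le_div_iff₀ (by linarith)]
    have : 0 ≤ T * ε * (1 + 2 * ε) := by positivity
    nlinarith
  rw [abs_le]
  constructor <;> linarith

/-- The deviation of the empirical covariance form from the covariance form, after recentring the
functions at their `P`-means, in terms of the Frobenius norm of the entrywise deviations. -/
lemma abs_empVar_sub_le {P : Measure E} [IsProbabilityMeasure P] {G : Finset (E → ℝ)}
    (X : ℕ → Ω → E) {n : ℕ} (hn : 1 ≤ n) (ω : Ω) (d : G → ℝ) :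
    |empVar X n ω d - d ⬝ᵥ covMatrix P G *ᵥ d| ≤
      (√(∑ f : G, ∑ g : G, (empMean X n (fun x => (f.1 x - ∫ y, f.1 y ∂P) *
          (g.1 x - ∫ y, g.1 y ∂P)) ω - covMatrix P G f g) ^ 2) +
        ∑ f : G, (empMean X n f ω - ∫ y, f.1 y ∂P) ^ 2) * (d ⬝ᵥ d) := by
  set m : G → ℝ := fun f => ∫ y, f.1 y ∂P with hm
  set v : G → ℝ := fun f => empMean X n f ω - m f with hv
  set M : G → G → ℝ := fun f g => empMean X n (fun x => (f.1 x - m f) * (g.1 x - m g)) ω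
    - covMatrix P G f g with hM
  have hprod : ∀ f g : G, empMean X n (fun x => (f.1 x - m f) * (g.1 x - m g)) ω =
      empMean X n (f.1 * g.1) ω - m f * empMean X n g.1 ω - m g * empMean X n f.1 ω
        + m f * m g := by
    intro f g
    have : (fun x => (f.1 x - m f) * (g.1 x - m g)) = f.1 * g.1 + (-(m f)) • g.1 +
        (-(m g)) • f.1 + (m f * m g) • (1 : E → ℝ) := by
      ext x
      simp only [Pi.add_apply, Pi.mul_apply, Pi.smul_apply, Pi.one_apply, smul_eq_mul]
      ring
    rw [this]
    simp only [empMean_add, empMean_smul, empMean_one X hn]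
    ring
  have hS : d ⬝ᵥ covMatrix P G *ᵥ d = ∑ f, ∑ g, d f * d g * covMatrix P G f g := by
    simp only [dotProduct, mulVec, Finset.mul_sum]
    exact Finset.sum_congr rfl fun f _ => Finset.sum_congr rfl fun g _ => by ring
  have hdec : empVar X n ω d - d ⬝ᵥ covMatrix P G *ᵥ d =
      ∑ f, ∑ g, d f * d g * M f g - (d ⬝ᵥ v) ^ 2 := by
    rw [hS, empVar_eq_sum, sq, dotProduct, Finset.sum_mul_sum, ← Finset.sum_sub_distrib,
      ← Finset.sum_sub_distrib]
    refine Finset.sum_congr rfl fun f _ => ?_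
    rw [← Finset.sum_sub_distrib, ← Finset.sum_sub_distrib]
    refine Finset.sum_congr rfl fun g _ => ?_
    simp only [hM, hv, hprod]
    ring
  have h1 := abs_sum_mul_mul_le M d
  have h2 : (d ⬝ᵥ v) ^ 2 ≤ (d ⬝ᵥ d) * ∑ f, v f ^ 2 := by
    simpa [dotProduct, sq] using Finset.sum_mul_sq_le_sq_mul_sq Finset.univ d v
  rw [hdec]
  refine (abs_sub _ _).trans ?_
  rw [abs_of_nonneg (sq_nonneg (d ⬝ᵥ v)), add_mul]
  linarith

end Reduction

/-! ### Moments: Gaussian laws, pregaussian and KMT classes, empirical means -/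

section Moments

/-- Anticoncentration of the Gaussian law, from the bound of its density. -/
lemma gaussianReal_abs_le {v : NNReal} (hv : v ≠ 0) (m : ℝ) :
    gaussianReal 0 v {x | |x| ≤ m} ≤ ENNReal.ofReal (2 * m / √(2 * Real.pi * v)) := by
  have hs : {x : ℝ | |x| ≤ m} = Set.Icc (-m) m := by ext x; simp [abs_le]
  rw [gaussianReal_apply 0 hv, hs]
  calc ∫⁻ x in Set.Icc (-m) m, gaussianPDF 0 v x
      ≤ ∫⁻ _ in Set.Icc (-m) m, ENNReal.ofReal (√(2 * Real.pi * v))⁻¹ := by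
        refine lintegral_mono fun x => ENNReal.ofReal_le_ofReal ?_
        rw [gaussianPDFReal_def]
        refine mul_le_of_le_one_right (by positivity) (Real.exp_le_one_iff.2 ?_)
        exact div_nonpos_of_nonpos_of_nonneg (by nlinarith [sq_nonneg (x - 0)]) (by positivity)
    _ = ENNReal.ofReal (2 * m / √(2 * Real.pi * v)) := by
        rw [setLIntegral_const, Real.volume_Icc, ← ENNReal.ofReal_mul (by positivity)]
        congr 1
        ring

lemma lintegral_pow_four_gaussianReal (v : NNReal) :
    ∫⁻ x, ENNReal.ofReal (x ^ 4) ∂gaussianReal 0 v =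
      ENNReal.ofReal (v ^ 2) * ∫⁻ x, ENNReal.ofReal (x ^ 4) ∂gaussianReal 0 1 := by
  have h : gaussianReal 0 v = (gaussianReal 0 1).map (√(v : ℝ) * ·) := by
    rw [gaussianReal_map_const_mul]
    congr 1
    · simp
    · ext; simp
  rw [h, lintegral_map (by fun_prop) (by fun_prop), ← lintegral_const_mul _ (by fun_prop)]
  refine lintegral_congr fun x => ?_
  rw [← ENNReal.ofReal_mul (by positivity), mul_pow]
  congr 2
  rw [show (4 : ℕ) = 2 * 2 by norm_num, pow_mul, Real.sq_sqrt (NNReal.coe_nonneg v)]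

lemma integrable_pow_four_gaussianReal :
    Integrable (fun x : ℝ => x ^ 4) (gaussianReal 0 1) := by
  have := (memLp_id_gaussianReal (μ := 0) (v := 1) 4).integrable_norm_pow (p := 4) (by norm_num)
  refine this.congr (.of_forall fun x => ?_)
  simp only [id_eq, Real.norm_eq_abs]
  exact Even.pow_abs (by decide) x

lemma lintegral_pow_four_gaussianReal_lt_top :
    ∫⁻ x, ENNReal.ofReal (x ^ 4) ∂gaussianReal 0 1 < ⊤ := by
  rw [← ofReal_integral_eq_lintegral_ofReal integrable_pow_four_gaussianReal
    (.of_forall fun x => by positivity)]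
  exact ENNReal.ofReal_lt_top

/-- The fourth moment gives the square of a standard Gaussian variable the variance `3 - 1 = 2`. -/
lemma integral_pow_four_gaussianReal : ∫ x, x ^ 4 ∂gaussianReal 0 1 = 3 := by
  rw [integral_gaussianReal_eq_integral_smul one_ne_zero]
  have h1 : ∀ x : ℝ, gaussianPDFReal 0 1 x • x ^ 4 =
      (fun y : ℝ => (√(2 * Real.pi))⁻¹ * (y ^ (4 : ℝ) * Real.exp (-(1 / 2) * y ^ (2 : ℝ)))) |x| := by
    intro x
    simp only [gaussianPDFReal_def, smul_eq_mul, NNReal.coe_one, mul_one, sub_zero]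
    rw [Real.rpow_two, sq_abs, show (4 : ℝ) = ((4 : ℕ) : ℝ) by norm_num, Real.rpow_natCast,
      Even.pow_abs (by decide), show -x ^ 2 / 2 = -(1 / 2) * x ^ 2 by ring]
    ring
  simp_rw [h1]
  rw [integral_comp_abs (f := fun y : ℝ => (√(2 * Real.pi))⁻¹ *
    (y ^ (4 : ℝ) * Real.exp (-(1 / 2) * y ^ (2 : ℝ)))), integral_const_mul,
    integral_rpow_mul_exp_neg_mul_rpow (by norm_num) (by norm_num) (by norm_num),
    show ((4 : ℝ) + 1) / 2 = ((2 : ℕ) : ℝ) + 1 / 2 by norm_num, Real.Gamma_nat_add_half]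
  have h2 : (1 / 2 : ℝ) ^ (-((4 : ℝ) + 1) / 2) = 4 * √2 := by
    rw [show -((4 : ℝ) + 1) / 2 = -(((2 : ℕ) : ℝ) + 1 / 2) by norm_num, one_div (2 : ℝ),
      Real.inv_rpow (by norm_num), Real.rpow_neg (by norm_num), inv_inv,
      Real.rpow_add (by norm_num), Real.rpow_natCast, ← one_div, ← Real.sqrt_eq_rpow]
    norm_num
  have h3 : ((2 * 2 - 1 : ℕ).doubleFactorial : ℝ) = 3 := by norm_num [Nat.doubleFactorial]
  rw [h2, h3, Real.sqrt_mul (by norm_num)]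
  have : √(2 : ℝ) ≠ 0 := by positivity
  have : √Real.pi ≠ 0 := by positivity
  field_simp
  norm_num

variable {E : Type*} [MeasurableSpace E]

lemma IsBrownianBridge.hasLaw {Ω : Type*} [MeasurableSpace Ω] {P : Measure E} {𝓕 : Set (E → ℝ)}
    {B : 𝓕 → Ω → ℝ} {μ : Measure Ω} (h : IsBrownianBridge P 𝓕 B μ) (f : 𝓕) :
    HasLaw (B f) (gaussianReal 0 Var[(f : E → ℝ); P].toNNReal) μ where
  aemeasurable := h.gaussian.aemeasurable f
  map_eq := by
    rw [(h.gaussian.hasGaussianLaw_eval f).map_eq_gaussianReal, h.mean_zero,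
      ← covariance_self (h.gaussian.aemeasurable f), h.covariance_eq,
      covariance_self (h.memLp f f.2).aemeasurable]

/-- A pregaussian class has uniformly bounded variances: a common bound `m` of the sample paths
with probability larger than `1/2` bounds the standard deviations by anticoncentration. -/
lemma IsPregaussian.exists_variance_le {P : Measure E} {𝓕 : Set (E → ℝ)}
    (h : IsPregaussian P 𝓕) : ∃ V : ℝ, ∀ f ∈ 𝓕, Var[f; P] ≤ V := by
  obtain ⟨Ω, _, μ, B, hμ, hB, hae⟩ := h
  set s : ℕ → Set Ω := fun m => {ω | ∀ f, |B f ω| ≤ m} with hs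
  have hmono : Monotone s := fun m m' hm ω hω f => (hω f).trans (by exact_mod_cast hm)
  have huniv : μ (⋃ m, s m) = 1 := by
    refine (measure_congr (eventuallyEq_univ.2 ?_)).trans measure_univ
    filter_upwards [hae] with ω hω
    obtain ⟨C, hC⟩ := hω.1
    obtain ⟨m, hm⟩ := exists_nat_ge C
    exact Set.mem_iUnion.2 ⟨m, fun f => (hC f).trans hm⟩
  rw [hmono.measure_iUnion] at huniv
  obtain ⟨m, hm⟩ : ∃ m, 1 / 2 < μ (s m) := by
    rw [← lt_iSup_iff, huniv]
    exact ENNReal.half_lt_self one_ne_zero ENNReal.one_ne_top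
  refine ⟨16 * m ^ 2, fun f hf => ?_⟩
  have hle : μ (s m) ≤ gaussianReal 0 Var[f; P].toNNReal {x | |x| ≤ m} := by
    have hl := hB.hasLaw ⟨f, hf⟩
    rw [← hl.map_eq, Measure.map_apply_of_aemeasurable hl.aemeasurable
      (measurableSet_le continuous_abs.measurable measurable_const)]
    exact measure_mono fun ω hω => hω ⟨f, hf⟩
  rcases eq_or_ne Var[f; P].toNNReal 0 with h0 | h0
  · rw [Real.toNNReal_eq_zero] at h0
    exact h0.trans (by positivity)
  have h1 := hm.trans_le (hle.trans (gaussianReal_abs_le h0 m))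
  rw [Real.coe_toNNReal _ (variance_nonneg _ _),
    show (1 / 2 : ℝ≥0∞) = ENNReal.ofReal (1 / 2) by
      rw [ENNReal.ofReal_div_of_pos (by norm_num)]; simp] at h1
  have hV : 0 < Var[f; P] := by
    by_contra! hcon
    exact h0 (Real.toNNReal_eq_zero.2 hcon)
  have h2 : (1 / 2 : ℝ) < 2 * m / √(2 * Real.pi * Var[f; P]) := by
    by_contra! hcon
    exact absurd (ENNReal.ofReal_le_ofReal hcon) (not_le.2 h1)
  rw [lt_div_iff₀ (by positivity)] at h2
  have h3 : √(2 * Real.pi * Var[f; P]) < 4 * m := by linarith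
  rw [Real.sqrt_lt' (by linarith [Real.sqrt_nonneg (2 * Real.pi * Var[f; P])])] at h3
  nlinarith [Real.pi_gt_three]

/-- The exponential tail in the `KMT` property for the sample size `n = 1`, together with the
bounded variances, bounds the centred fourth moments of the whole class. -/
lemma IsKMT.exists_integral_pow_four_le {P : Measure E} {𝓕 : Set (E → ℝ)} {δ : ℕ → ℝ}
    (h : IsKMT δ P 𝓕) (hm : ∀ f ∈ 𝓕, Measurable f) : ∃ M : ℝ, ∀ f ∈ 𝓕,
      Integrable (fun x => (f x - ∫ y, f y ∂P) ^ 4) P ∧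
      ∫ x, (f x - ∫ y, f y ∂P) ^ 4 ∂P ≤ M := by
  obtain ⟨V, hV⟩ := h.1.exists_variance_le
  obtain ⟨-, Ω, _, μ, X, B, b, c, θ, hμ, hX, -, hB, -, hc, hθ, hK⟩ := h
  -- a positive upper bound of `δ 1`, so that no sign of `δ 1` is needed
  set D : ℝ := max (δ 1) 1 with hD
  have hD0 : 0 < D := lt_of_lt_of_le one_pos (le_max_right _ _)
  set I : ℝ≥0∞ := ∫⁻ t in Set.Ioi (0 : ℝ), ENNReal.ofReal (c * Real.exp (-(θ / D) * t)) *
    ENNReal.ofReal (t ^ ((4 : ℝ) - 1)) with hI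
  set K : ℝ≥0∞ := ∫⁻ x, ENNReal.ofReal (x ^ 4) ∂gaussianReal 0 1 with hKdef
  have hI_top : I < ⊤ := by
    have hint := (integrableOn_rpow_mul_exp_neg_mul_rpow (p := 1) (s := 3) (b := θ / D)
      (by norm_num) one_pos (by positivity)).const_mul c
    refine lt_of_le_of_lt (le_of_eq ?_) hint.lintegral_lt_top
    refine setLIntegral_congr_fun measurableSet_Ioi fun t ht => ?_
    have ht' : (0 : ℝ) < t := ht
    rw [← ENNReal.ofReal_mul (by positivity), Real.rpow_one]
    norm_num
    congr 1
    ring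
  set C : ℝ≥0∞ := 8 * (ENNReal.ofReal 4 * I) + 8 * (ENNReal.ofReal (V ^ 2) * K) with hC
  have hC_top : C ≠ ⊤ := by
    have hK_top : K < ⊤ := lintegral_pow_four_gaussianReal_lt_top
    finiteness
  refine ⟨C.toReal, fun f hf => ?_⟩
  have hmf : Measurable f := hm f hf
  have hBl := (hB 1 le_rfl).hasLaw ⟨f, hf⟩
  have hγ : ∀ ω, gammaN X P 1 f ω = f (X 0 ω) - ∫ y, f y ∂P := by
    intro ω; simp [gammaN, empMean]
  have hXm : AEMeasurable (X 0) μ := (hX 0).aemeasurable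
  have hBm : AEMeasurable (B 1 ⟨f, hf⟩) μ := hBl.aemeasurable
  have hfX : AEMeasurable (fun ω => f (X 0 ω)) μ := hmf.comp_aemeasurable hXm
  set W : Ω → ℝ := fun ω => |f (X 0 ω) - ∫ y, f y ∂P - B 1 ⟨f, hf⟩ ω| with hW
  have hWm : AEMeasurable W μ := by
    have := (hfX.sub_const (∫ y, f y ∂P)).sub hBm
    exact this.norm
  have htail : ∀ t : ℝ, 0 < t → μ {ω | t ≤ W ω} ≤
      ENNReal.ofReal (c * Real.exp (-(θ / D) * t)) := by
    intro t ht
    have h1 := hK 1 le_rfl (t / D) (by positivity)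
    rw [show -θ * (t / D) = -(θ / D) * t by ring] at h1
    refine le_trans (measure_mono fun ω hω => ?_) h1
    refine le_trans (ENNReal.ofReal_le_ofReal ?_)
      (le_iSup (fun g : 𝓕 => ENNReal.ofReal |gammaN X P 1 g ω - B 1 g ω|) ⟨f, hf⟩)
    rw [hγ]
    simp only [Nat.cast_one, Real.log_one, mul_zero, add_zero]
    calc δ 1 * (t / D) ≤ D * (t / D) := by gcongr; exact le_max_left _ _
      _ = t := by field_simp
      _ ≤ _ := hω
  have hW4 : ∫⁻ ω, ENNReal.ofReal (W ω ^ 4) ∂μ ≤ ENNReal.ofReal 4 * I := by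
    have h1 := lintegral_rpow_eq_lintegral_meas_le_mul μ (f := W)
      (.of_forall fun ω => abs_nonneg _) hWm (p := 4) (by norm_num)
    have h2 : ∀ ω, W ω ^ 4 = W ω ^ (4 : ℝ) := fun ω => by
      rw [show (4 : ℝ) = ((4 : ℕ) : ℝ) by norm_num, Real.rpow_natCast]
    simp_rw [h2]
    rw [h1]
    gcongr
    refine setLIntegral_mono' measurableSet_Ioi fun t ht => ?_
    gcongr
    exact htail t ht
  have hB4 : ∫⁻ ω, ENNReal.ofReal (B 1 ⟨f, hf⟩ ω ^ 4) ∂μ ≤ ENNReal.ofReal (V ^ 2) * K := by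
    rw [hBl.lintegral_comp (f := fun x => ENNReal.ofReal (x ^ 4)) (by fun_prop),
      lintegral_pow_four_gaussianReal, Real.coe_toNNReal _ (variance_nonneg _ _)]
    gcongr
    · exact variance_nonneg _ _
    · exact hV f hf
  -- by convexity, `u ^ 4 ≤ 8 ((u - w) ^ 4 + w ^ 4)`
  have hsum : ∫⁻ x, ENNReal.ofReal ((f x - ∫ y, f y ∂P) ^ 4) ∂P ≤ C := by
    rw [← (hX 0).lintegral_comp (f := fun x => ENNReal.ofReal ((f x - ∫ y, f y ∂P) ^ 4))
      (by fun_prop)]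
    calc ∫⁻ ω, ENNReal.ofReal ((f (X 0 ω) - ∫ y, f y ∂P) ^ 4) ∂μ
        ≤ ∫⁻ ω, (8 * ENNReal.ofReal (W ω ^ 4) + 8 * ENNReal.ofReal (B 1 ⟨f, hf⟩ ω ^ 4)) ∂μ := by
          refine lintegral_mono fun ω => ?_
          rw [show (8 : ℝ≥0∞) = ENNReal.ofReal 8 by norm_num, ← ENNReal.ofReal_mul (by norm_num),
            ← ENNReal.ofReal_mul (by norm_num), ← ENNReal.ofReal_add (by positivity)
            (by positivity)]
          refine ENNReal.ofReal_le_ofReal ?_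
          simp only [hW]
          rw [Even.pow_abs (by decide)]
          set u := f (X 0 ω) - ∫ y, f y ∂P
          set w := B 1 ⟨f, hf⟩ ω
          nlinarith [sq_nonneg (u - 2 * w), sq_nonneg u, sq_nonneg w, sq_nonneg (u * (u - 2 * w)),
            sq_nonneg (w * (u - 2 * w)), sq_nonneg ((u - 2 * w) ^ 2), sq_nonneg (u ^ 2),
            sq_nonneg ((u - w) ^ 2 - w ^ 2)]
      _ ≤ C := by
          rw [lintegral_add_left' (by fun_prop), lintegral_const_mul'' _ (by fun_prop),
            lintegral_const_mul'' _ (by fun_prop), hC]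
          gcongr
  have hmeas : AEStronglyMeasurable (fun x => (f x - ∫ y, f y ∂P) ^ 4) P :=
    Measurable.aestronglyMeasurable (by fun_prop)
  have hnn : 0 ≤ᵐ[P] fun x => (f x - ∫ y, f y ∂P) ^ 4 :=
    .of_forall fun x => (by decide : Even 4).pow_nonneg _
  refine ⟨⟨hmeas, ?_⟩, ?_⟩
  · rw [hasFiniteIntegral_iff_ofReal hnn]
    exact hsum.trans_lt hC_top.lt_top
  · rw [integral_eq_lintegral_of_nonneg_ae hnn hmeas]
    exact ENNReal.toReal_mono hC_top hsum

/-- The mean squared error of an empirical mean. -/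
lemma integral_sq_empMean_sub_le {Ω : Type*} [MeasurableSpace Ω] {μ : Measure Ω}
    [IsProbabilityMeasure μ] {P : Measure E} [IsProbabilityMeasure P] {X : ℕ → Ω → E}
    (hX : ∀ i, HasLaw (X i) P μ) (hind : iIndepFun X μ) {φ : E → ℝ} (hφ : Measurable φ)
    (hφ2 : MemLp φ 2 P) {n : ℕ} (hn : 1 ≤ n) :
    Integrable (fun ω => (empMean X n φ ω - ∫ x, φ x ∂P) ^ 2) μ ∧
      ∫ ω, (empMean X n φ ω - ∫ x, φ x ∂P) ^ 2 ∂μ = Var[φ; P] / n := by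
  have hn0 : (0 : ℝ) < n := by positivity
  have hlp : ∀ i, MemLp (φ ∘ X i) 2 μ := fun i =>
    MemLp.comp_of_map (by rwa [(hX i).map_eq]) (hX i).aemeasurable
  have hmean : ∀ i, ∫ ω, φ (X i ω) ∂μ = ∫ x, φ x ∂P := fun i =>
    (hX i).integral_comp hφ2.aestronglyMeasurable
  have hvar : ∀ i, Var[φ ∘ X i; μ] = Var[φ; P] := fun i => by
    rw [← variance_map (by rw [(hX i).map_eq]; exact hφ.aemeasurable) (hX i).aemeasurable,
      (hX i).map_eq]
  have heq : empMean X n φ = fun ω => (n : ℝ)⁻¹ * (∑ i ∈ Finset.range n, φ ∘ X i) ω := by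
    ext ω; simp [empMean]
  have hlpS : MemLp (∑ i ∈ Finset.range n, φ ∘ X i) 2 μ := memLp_finsetSum' _ fun i _ => hlp i
  have hlpY : MemLp (empMean X n φ) 2 μ := by rw [heq]; exact hlpS.const_mul _
  have hmeanY : ∫ ω, empMean X n φ ω ∂μ = ∫ x, φ x ∂P := by
    simp only [empMean]
    rw [integral_const_mul, integral_finsetSum (f := fun i ω => φ (X i ω)) _
      fun i _ => (hlp i).integrable (by norm_num)]
    simp only [hmean]
    simp
    field_simp
  have hvarY : Var[empMean X n φ; μ] = Var[φ; P] / n := by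
    rw [heq, variance_const_mul, IndepFun.variance_sum (fun i _ => hlp i)]
    · simp only [hvar]
      simp
      field_simp
    · intro i _ j _ hij
      exact (hind.indepFun hij).comp hφ hφ
  have hY2 := variance_eq_integral hlpY.aemeasurable
  rw [hmeanY, hvarY] at hY2
  exact ⟨(hlpY.sub (memLp_const _)).integrable_sq, hY2.symm⟩

end Moments

/-! ### The chi-square law and whitened Brownian bridges -/

section ChiSquareLaw

/-- The law of a sum of squares of independent standard Gaussian variables, the `χ²` law, depends
only on their number. -/
lemma map_sum_sq_eq {ι ι' Ω Ω' : Type*} [Fintype ι] [Fintype ι'] [MeasurableSpace Ω]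
    [MeasurableSpace Ω'] {μ : Measure Ω} {μ' : Measure Ω'} [IsProbabilityMeasure μ]
    [IsProbabilityMeasure μ'] (e : ι ≃ ι') {Y : ι → Ω → ℝ} {Y' : ι' → Ω' → ℝ}
    (hY : ∀ i, HasLaw (Y i) (gaussianReal 0 1) μ) (hYi : iIndepFun Y μ)
    (hY' : ∀ i, HasLaw (Y' i) (gaussianReal 0 1) μ') (hYi' : iIndepFun Y' μ') :
    μ.map (fun ω => ∑ i, Y i ω ^ 2) = μ'.map (fun ω => ∑ i, Y' i ω ^ 2) := by
  have h1 := (iIndepFun_iff_map_fun_eq_pi_map fun i => (hY i).aemeasurable).1 hYi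
  have h2 := (iIndepFun_iff_map_fun_eq_pi_map fun i => (hY' (e i)).aemeasurable).1
    (hYi'.precomp e.injective)
  simp only [(hY _).map_eq] at h1
  simp only [(hY' _).map_eq] at h2
  have hg : Measurable fun y : ι → ℝ => ∑ i, y i ^ 2 := by fun_prop
  have e1 : (fun ω => ∑ i, Y i ω ^ 2) = (fun y : ι → ℝ => ∑ i, y i ^ 2) ∘ fun ω i => Y i ω := rfl
  have e2 : (fun ω => ∑ i, Y' i ω ^ 2) =
      (fun y : ι → ℝ => ∑ i, y i ^ 2) ∘ fun ω i => Y' (e i) ω := by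
    ext ω
    exact (Equiv.sum_comp e fun i => Y' i ω ^ 2).symm
  rw [e1, e2, ← AEMeasurable.map_map_of_aemeasurable hg.aemeasurable
      (aemeasurable_pi_lambda _ fun i => (hY i).aemeasurable),
    ← AEMeasurable.map_map_of_aemeasurable hg.aemeasurable
      (aemeasurable_pi_lambda _ fun i => (hY' (e i)).aemeasurable), h1, h2]

lemma integral_sq_of_hasLaw {Ω : Type*} [MeasurableSpace Ω] {μ : Measure Ω}
    {Y : Ω → ℝ} (hY : HasLaw Y (gaussianReal 0 1) μ) :
    Integrable (fun ω => Y ω ^ 2) μ ∧ ∫ ω, Y ω ^ 2 ∂μ = 1 := by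
  have h2 : MemLp Y 2 μ := by
    have := memLp_id_gaussianReal (μ := 0) (v := 1) 2
    rw [← hY.map_eq] at this
    exact MemLp.comp_of_map (g := id) this hY.aemeasurable
  refine ⟨h2.integrable_sq, ?_⟩
  have h0 : ∫ ω, Y ω ∂μ = 0 := by
    have := hY.integral_comp (f := id) aestronglyMeasurable_id
    simpa using this
  have hv := hY.variance_eq
  rw [variance_eq_integral hY.aemeasurable, h0, variance_id_gaussianReal] at hv
  simpa using hv

/-- The central limit theorem for the `χ²` laws. -/
lemma tendstoInDistribution_sum_sq {Ω : Type*} [MeasurableSpace Ω] {μ : Measure Ω}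
    [IsProbabilityMeasure μ] {ξ : ℕ → Ω → ℝ} (hξ : ∀ i, HasLaw (ξ i) (gaussianReal 0 1) μ)
    (hind : iIndepFun ξ μ) :
    TendstoInDistribution
      (fun (k : ℕ) ω => (∑ i ∈ Finset.range k, ξ i ω ^ 2 - k) / √(2 * k)) atTop
      (id : ℝ → ℝ) (fun _ => μ) (gaussianReal 0 1) := by
  have hg : Measurable fun x : ℝ => (x ^ 2 - 1) / √2 := by fun_prop
  have h1 : ∫ ω, ((ξ 0 ω ^ 2 - 1) / √2) ∂μ = 0 := by
    obtain ⟨hi, h⟩ := integral_sq_of_hasLaw (hξ 0)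
    rw [integral_div, integral_sub hi (integrable_const _), h]
    simp
  have h2 : ∫ ω, ((ξ 0 ω ^ 2 - 1) / √2) ^ 2 ∂μ = 1 := by
    have h := (hξ 0).integral_comp (f := fun x : ℝ => ((x ^ 2 - 1) / √2) ^ 2)
      (Measurable.aestronglyMeasurable (by fun_prop))
    have h4 := integrable_pow_four_gaussianReal
    obtain ⟨hi, hi2⟩ := integral_sq_of_hasLaw (HasLaw.mk (μ := gaussianReal 0 1)
      (P := gaussianReal 0 1) (X := id) aemeasurable_id Measure.map_id)
    simp only [id_eq] at hi hi2
    refine h.trans ?_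
    have : ∀ x : ℝ, ((x ^ 2 - 1) / √2) ^ 2 = (x ^ 4 - 2 * x ^ 2 + 1) / 2 := fun x => by
      rw [div_pow, Real.sq_sqrt (by norm_num)]; ring
    simp_rw [this]
    rw [integral_div, integral_add (f := fun x : ℝ => x ^ 4 - 2 * x ^ 2)
        (h4.sub (hi.const_mul 2)) (integrable_const _),
      integral_sub h4 (hi.const_mul 2), integral_const_mul, hi2, integral_pow_four_gaussianReal]
    simp
    norm_num
  have hident : ∀ i, IdentDistrib (fun ω => (ξ i ω ^ 2 - 1) / √2) (fun ω => (ξ 0 ω ^ 2 - 1) / √2)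
      μ μ := fun i =>
    IdentDistrib.comp (u := fun x : ℝ => (x ^ 2 - 1) / √2)
      ⟨(hξ i).aemeasurable, (hξ 0).aemeasurable, by rw [(hξ i).map_eq, (hξ 0).map_eq]⟩ hg
  have hclt := tendstoInDistribution_inv_sqrt_mul_sum (P := μ) (P' := gaussianReal 0 1)
    (Y := (id : ℝ → ℝ)) ⟨aemeasurable_id, Measure.map_id⟩
    (X := fun i ω => (ξ i ω ^ 2 - 1) / √2) h1 h2
    (hind.comp (fun _ x => (x ^ 2 - 1) / √2) fun _ => hg) hident
  convert! hclt using 3 with k ω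
  rw [← Finset.sum_div, Finset.sum_sub_distrib, Real.sqrt_mul (by norm_num)]
  simp only [Finset.sum_const, Finset.card_range, nsmul_eq_mul, mul_one]
  rw [div_eq_mul_inv, mul_inv, div_eq_mul_inv]
  ring

end ChiSquareLaw

section Bridge

variable {E : Type*} [MeasurableSpace E] {Ω : Type*} [MeasurableSpace Ω] {μ : Measure Ω}
  {P : Measure E} {𝓕 : Set (E → ℝ)} {B : 𝓕 → Ω → ℝ} {G : Finset (E → ℝ)}

/-- A whitening matrix of the covariance matrix turns the restriction of a Brownian bridge to a
finite set of functions into a vector of independent standard Gaussian variables. -/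
lemma IsBrownianBridge.whiten [IsProbabilityMeasure μ] (hB : IsBrownianBridge P 𝓕 B μ)
    (hG : ∀ f ∈ G, f ∈ 𝓕) [DecidableEq G] {A : Matrix G G ℝ} (hA : A * covMatrix P G * Aᵀ = 1) :
    (∀ j, HasLaw (fun ω => (A *ᵥ fun f : G => B ⟨f, hG f f.2⟩ ω) j) (gaussianReal 0 1) μ) ∧
      iIndepFun (fun j ω => (A *ᵥ fun f : G => B ⟨f, hG f f.2⟩ ω) j) μ := by
  set b : G → Ω → ℝ := fun f => B ⟨f, hG f f.2⟩ with hb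
  have hbg : IsGaussianProcess b μ := hB.gaussian.comp_right fun f : G => (⟨f, hG f f.2⟩ : 𝓕)
  set Y : G → Ω → ℝ := fun j ω => (A *ᵥ fun f : G => b f ω) j with hY
  have hYg : HasGaussianLaw (fun ω j => Y j ω) μ := by
    let L : (↥(Finset.univ : Finset G) → ℝ) →ₗ[ℝ] (G → ℝ) :=
      (Matrix.mulVecLin A).comp
        (LinearMap.funLeft ℝ ℝ fun f : G => (⟨f, Finset.mem_univ f⟩ : ↥(Finset.univ : Finset G)))
    exact (hbg.hasGaussianLaw Finset.univ).map (LinearMap.toContinuousLinearMap L)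
  have hb2 : ∀ f, MemLp (b f) 2 μ := fun f => (hbg.hasGaussianLaw_eval f).memLp_two
  have hcov : ∀ i j, cov[Y i, Y j; μ] = (1 : Matrix G G ℝ) i j := by
    intro i j
    have hs : ∀ i, Y i = fun ω => ∑ f, A i f * b f ω := fun i => rfl
    rw [hs, hs, covariance_fun_sum_fun_sum (fun f => (hb2 f).const_mul _)
      (fun f => (hb2 f).const_mul _), ← hA]
    simp only [Matrix.mul_apply, Matrix.transpose_apply, Finset.sum_mul]
    rw [Finset.sum_comm]
    refine Finset.sum_congr rfl fun f _ => Finset.sum_congr rfl fun g _ => ?_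
    rw [covariance_const_mul_left, covariance_const_mul_right, hB.covariance_eq]
    simp only [covMatrix, Matrix.of_apply]
    ring
  have hmean : ∀ j, ∫ ω, Y j ω ∂μ = 0 := by
    intro j
    have : ∀ ω, Y j ω = ∑ f, A j f * b f ω := fun ω => rfl
    simp_rw [this]
    rw [integral_finsetSum _ fun f _ => ((hb2 f).integrable (by norm_num)).const_mul _]
    simp only [integral_const_mul]
    exact Finset.sum_eq_zero fun f _ => by rw [hB.mean_zero, mul_zero]
  have hYe : ∀ j, HasGaussianLaw (Y j) μ := fun j => hYg.eval j
  refine ⟨fun j => ⟨(hYe j).aemeasurable, ?_⟩, ?_⟩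
  · rw [(hYe j).map_eq_gaussianReal, ← covariance_self (hYe j).aemeasurable, hcov, hmean]
    simp
  · refine hYg.iIndepFun_of_covariance_eq_zero fun i j hij => ?_
    rw [hcov, Matrix.one_apply_ne hij]

end Bridge

/-! ### The coupling for a fixed sample size -/

section FiniteSample

lemma measure_ge_le_ofReal_div {Ω : Type*} [MeasurableSpace Ω] {μ : Measure Ω}
    [IsFiniteMeasure μ] {f : Ω → ℝ} (hf : Integrable f μ) (h0 : ∀ ω, 0 ≤ f ω) {a ε : ℝ}
    (ha : ∫ ω, f ω ∂μ ≤ a) (hε : 0 < ε) : μ {ω | ε ≤ f ω} ≤ ENNReal.ofReal (a / ε) := by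
  have h := mul_meas_ge_le_integral_of_nonneg (.of_forall h0) hf ε
  rw [← ofReal_measureReal]
  refine ENNReal.ofReal_le_ofReal ?_
  rw [le_div_iff₀ hε, mul_comm]
  exact h.trans ha

variable {E : Type*} [MeasurableSpace E] {Ω : Type*} {P : Measure E} [IsProbabilityMeasure P]
  {G : Finset (E → ℝ)} {X : ℕ → Ω → E}

/-- The deterministic core: on the event where the empirical covariance form has relative error
`ε ≤ η k^{-1/2}`, the whitened empirical process `a` is `η`-close to the whitened bridge `b`, and
`|b|² ≤ K k`, the normalised statistic `y` differs from `|b|²` by at most `8 K η √k`. -/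
lemma abs_sub_dotProduct_self_le {ι : Type*} [Fintype ι] (a b : ι → ℝ) {k K η ε y : ℝ}
    (hk : 1 ≤ k) (hK : 1 ≤ K) (hη : 0 ≤ η) (hη2 : η ≤ 1 / 2)
    (hε : √k * ε ≤ η) (hab : (a - b) ⬝ᵥ (a - b) ≤ η ^ 2) (hb : b ⬝ᵥ b ≤ K * k)
    (hy : |y - a ⬝ᵥ a| ≤ 2 * ε * (a ⬝ᵥ a)) :
    |y - b ⬝ᵥ b| ≤ 8 * K * η * √k := by
  have hk1 : 1 ≤ √k := by rw [Real.one_le_sqrt]; exact hk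
  have hkk : √k * √k = k := Real.mul_self_sqrt (by linarith)
  have hKk : √(K * k) ≤ K * √k := by
    rw [Real.sqrt_le_left (by positivity), mul_pow, sq √k, hkk]
    have : 0 ≤ k * K * (K - 1) := by
      apply mul_nonneg (by positivity); linarith
    nlinarith
  have h1 := abs_dotProduct_self_sub_le a b hη (Real.sqrt_nonneg (K * k)) hab
    (by rwa [Real.sq_sqrt (by positivity)])
  have hKk1 : 1 ≤ K * √k := by nlinarith
  have h2 : |a ⬝ᵥ a - b ⬝ᵥ b| ≤ 3 * (K * η * √k) := by
    refine h1.trans ?_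
    have : η * (2 * √(K * k) + η) ≤ η * (2 * (K * √k) + K * √k) := by
      gcongr; linarith
    linarith
  have h3 : a ⬝ᵥ a ≤ 5 / 2 * K * k := by
    have h4 := (abs_le.1 h2).2
    have h5 : K * η * √k ≤ K * (1 / 2) * k := by
      rw [mul_assoc, mul_assoc]
      have : η * √k ≤ 1 / 2 * k := by nlinarith
      gcongr
    linarith
  have h6 : 2 * ε * (a ⬝ᵥ a) ≤ 5 * (K * η * √k) := by
    have ha0 : 0 ≤ a ⬝ᵥ a := by simpa using dotProduct_star_self_nonneg a
    have hε' : ε ≤ η / √k := by rw [le_div_iff₀ (by linarith), mul_comm]; exact hε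
    calc 2 * ε * (a ⬝ᵥ a) ≤ 2 * (η / √k) * (a ⬝ᵥ a) := by gcongr
      _ ≤ 2 * (η / √k) * (5 / 2 * K * k) := by gcongr
      _ = 5 * (K * η * √k) := by
        nth_rewrite 2 [← hkk]
        field_simp
  calc |y - b ⬝ᵥ b| = |(y - a ⬝ᵥ a) + (a ⬝ᵥ a - b ⬝ᵥ b)| := by ring_nf
    _ ≤ |y - a ⬝ᵥ a| + |a ⬝ᵥ a - b ⬝ᵥ b| := abs_add_le _ _
    _ ≤ 8 * K * η * √k := by linarith

/-- On the event where the empirical covariance matrix, the empirical process and the Gaussian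
vector `b` are under control, the statistic is finite and close to the squared length of the
whitened Gaussian vector. -/
lemma abs_chiSq_sub_le_of_close {Q : SignedMeasure E} (hQ : Q Set.univ = 1)
    (hQG : ∀ f ∈ G, Q.Integrable f ∧ ∫ᵛ x, f x ∂<•Q = ∫ x, f x ∂P)
    {n : ℕ} (hn : 1 ≤ n) (hk : 1 ≤ G.card) [DecidableEq G] {A : Matrix G G ℝ} {l : ℝ} (hl : 0 < l)
    (hray : ∀ d : G → ℝ, l * (d ⬝ᵥ d) ≤ d ⬝ᵥ covMatrix P G *ᵥ d)
    (hA : A * covMatrix P G * Aᵀ = 1) {K η s : ℝ} (hK : 1 ≤ K) (hη : 0 < η) (hη2 : η ≤ 1 / 2)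
    (hsη : l⁻¹ * G.card * s ^ 2 ≤ η ^ 2) (ω : Ω) (b : G → ℝ)
    (hD : ∑ f : G, ∑ g : G, (empMean X n (fun x => (f.1 x - ∫ y, f.1 y ∂P) *
      (g.1 x - ∫ y, g.1 y ∂P)) ω - covMatrix P G f g) ^ 2 < (η * l / (2 * √G.card)) ^ 2)
    (hV : ∑ f : G, (empMean X n f ω - ∫ y, f.1 y ∂P) ^ 2 < η * l / (2 * √G.card))
    (hs : ∀ f : G, |gammaN X P n f ω - b f| ≤ s)
    (hb : (A *ᵥ b) ⬝ᵥ (A *ᵥ b) ≤ K * G.card) :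
    chiSq Q X n G ω ≠ ⊤ ∧
      |n * (chiSq Q X n G ω).toReal - (A *ᵥ b) ⬝ᵥ (A *ᵥ b)| ≤ 8 * K * η * √G.card := by
  have hk1 : (1 : ℝ) ≤ (G.card : ℝ) := by exact_mod_cast hk
  have hcov := fun d : G → ℝ => abs_empVar_sub_le (P := P) X hn ω d
  have hV0 : 0 ≤ ∑ f : G, (empMean X n f ω - ∫ y, f.1 y ∂P) ^ 2 :=
    Finset.sum_nonneg fun f _ => sq_nonneg _
  generalize ∑ f : G, ∑ g : G, (empMean X n (fun x => (f.1 x - ∫ y, f.1 y ∂P) *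
      (g.1 x - ∫ y, g.1 y ∂P)) ω - covMatrix P G f g) ^ 2 = D at hD hcov
  generalize ∑ f : G, (empMean X n f ω - ∫ y, f.1 y ∂P) ^ 2 = V at hV hV0 hcov
  have hsk : 1 ≤ √(G.card : ℝ) := by rw [Real.one_le_sqrt]; exact hk1
  have hD' : √D < η * l / (2 * √G.card) := (Real.sqrt_lt' (by positivity)).2 hD
  have hε0 : 0 ≤ (√D + V) / l := by positivity
  have hεk : √(G.card : ℝ) * ((√D + V) / l) ≤ η := by
    have h2t : √D + V ≤ 2 * (η * l / (2 * √G.card)) := by linarith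
    calc √(G.card : ℝ) * ((√D + V) / l)
        ≤ √(G.card : ℝ) * (2 * (η * l / (2 * √G.card)) / l) := by gcongr
      _ = η := by field_simp
  have hε : (√D + V) / l ≤ 1 / 2 := by nlinarith
  have hq : ∀ d : G → ℝ, |empVar X n ω d - d ⬝ᵥ covMatrix P G *ᵥ d| ≤
      (√D + V) / l * (d ⬝ᵥ covMatrix P G *ᵥ d) := fun d => by
    refine (hcov d).trans ?_
    rw [div_mul_eq_mul_div, le_div_iff₀ hl, mul_assoc]
    refine mul_le_mul_of_nonneg_left ?_ (by positivity)
    rw [mul_comm]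
    exact hray d
  obtain ⟨hne, hle⟩ := chiSq_ne_top_and_abs_sub_le hQ hQG X hn ω hA hε0 hε hq rfl
  refine ⟨hne, ?_⟩
  refine abs_sub_dotProduct_self_le (A *ᵥ fun f : G => gammaN X P n f ω) (A *ᵥ b) hk1 hK hη.le hη2
    hεk ?_ hb hle
  rw [← mulVec_sub]
  refine (mulVec_dotProduct_self_le hl hray hA _).trans (le_trans ?_ hsη)
  rw [mul_assoc]
  refine mul_le_mul_of_nonneg_left ?_ (by positivity)
  have hf : ∀ f : G, (gammaN X P n f ω - b f) * (gammaN X P n f ω - b f) ≤ s ^ 2 := fun f => by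
    rw [← sq, ← sq_abs]
    exact pow_le_pow_left₀ (abs_nonneg _) (hs f) 2
  refine (Finset.sum_le_sum fun f _ => hf f).trans (le_of_eq ?_)
  simp

variable [MeasurableSpace Ω] {μ : Measure Ω} [IsProbabilityMeasure μ] {M : ℝ}

/-- The expected squared Frobenius distance of the (population-centred) empirical covariance matrix
from the covariance matrix. -/
lemma integral_sum_sq_empMean_sub_covMatrix_le (hX : ∀ i, HasLaw (X i) P μ)
    (hind : iIndepFun X μ) (hGm : ∀ f ∈ G, Measurable f)
    (hM : ∀ f ∈ G, Integrable (fun x => (f x - ∫ y, f y ∂P) ^ 4) P ∧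
      ∫ x, (f x - ∫ y, f y ∂P) ^ 4 ∂P ≤ M) {n : ℕ} (hn : 1 ≤ n) :
    Integrable (fun ω => ∑ f : G, ∑ g : G, (empMean X n (fun x => (f.1 x - ∫ y, f.1 y ∂P) *
          (g.1 x - ∫ y, g.1 y ∂P)) ω - covMatrix P G f g) ^ 2) μ ∧
      ∫ ω, (∑ f : G, ∑ g : G, (empMean X n (fun x => (f.1 x - ∫ y, f.1 y ∂P) *
          (g.1 x - ∫ y, g.1 y ∂P)) ω - covMatrix P G f g) ^ 2) ∂μ ≤ (G.card : ℝ) ^ 2 * M / n := by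
  have hn0 : (0 : ℝ) < n := by positivity
  have key : ∀ f g : G, Integrable (fun ω => (empMean X n (fun x => (f.1 x - ∫ y, f.1 y ∂P) *
          (g.1 x - ∫ y, g.1 y ∂P)) ω - covMatrix P G f g) ^ 2) μ ∧
      ∫ ω, (empMean X n (fun x => (f.1 x - ∫ y, f.1 y ∂P) *
          (g.1 x - ∫ y, g.1 y ∂P)) ω - covMatrix P G f g) ^ 2 ∂μ ≤ M / n := by
    intro f g
    have hfm := hGm f f.2
    have hgm := hGm g g.2
    set φ : E → ℝ := fun x => (f.1 x - ∫ y, f.1 y ∂P) * (g.1 x - ∫ y, g.1 y ∂P) with hφ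
    have hφm : Measurable φ := by fun_prop
    have hdom := (((hM f f.2).1.add (hM g g.2).1).div_const 2)
    have hle : ∀ x, φ x ^ 2 ≤
        ((f.1 x - ∫ y, f.1 y ∂P) ^ 4 + (g.1 x - ∫ y, g.1 y ∂P) ^ 4) / 2 := fun x => by
      simp only [hφ]
      nlinarith [sq_nonneg ((f.1 x - ∫ y, f.1 y ∂P) ^ 2 - (g.1 x - ∫ y, g.1 y ∂P) ^ 2)]
    have hφi : Integrable (fun x => φ x ^ 2) P := by
      refine hdom.mono' (by fun_prop) (.of_forall fun x => ?_)
      rw [Real.norm_of_nonneg (sq_nonneg _)]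
      exact hle x
    have hφ2 : MemLp φ 2 P := (memLp_two_iff_integrable_sq hφm.aestronglyMeasurable).2 hφi
    have hφM : ∫ x, φ x ^ 2 ∂P ≤ M := by
      refine (integral_mono hφi hdom hle).trans ?_
      simp only [Pi.add_apply]
      rw [integral_div, integral_add (hM f f.2).1 (hM g g.2).1]
      linarith [(hM f f.2).2, (hM g g.2).2]
    have hcov : covMatrix P G f g = ∫ x, φ x ∂P := rfl
    obtain ⟨h1, h2⟩ := integral_sq_empMean_sub_le hX hind hφm hφ2 hn
    rw [hcov]
    refine ⟨h1, h2.le.trans ?_⟩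
    gcongr
    exact (variance_le_expectation_sq hφ2.aestronglyMeasurable).trans hφM
  refine ⟨integrable_finsetSum _ fun f _ => integrable_finsetSum _ fun g _ => (key f g).1, ?_⟩
  rw [integral_finsetSum _ fun f _ => integrable_finsetSum _ fun g _ => (key f g).1]
  calc _ ≤ ∑ f : G, ∑ g : G, M / n := by
        refine Finset.sum_le_sum fun f _ => ?_
        rw [integral_finsetSum _ fun g _ => (key f g).1]
        exact Finset.sum_le_sum fun g _ => (key f g).2
    _ = (G.card : ℝ) ^ 2 * M / n := by simp; ring

lemma integral_sum_sq_empMean_sub_le (hX : ∀ i, HasLaw (X i) P μ)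
    (hind : iIndepFun X μ) (hGm : ∀ f ∈ G, Measurable f) (hG2 : ∀ f ∈ G, MemLp f 2 P)
    (hM : ∀ f ∈ G, Integrable (fun x => (f x - ∫ y, f y ∂P) ^ 4) P ∧
      ∫ x, (f x - ∫ y, f y ∂P) ^ 4 ∂P ≤ M) {n : ℕ} (hn : 1 ≤ n) :
    Integrable (fun ω => ∑ f : G, (empMean X n f ω - ∫ y, f.1 y ∂P) ^ 2) μ ∧
      ∫ ω, (∑ f : G, (empMean X n f ω - ∫ y, f.1 y ∂P) ^ 2) ∂μ ≤ G.card * (M + 1) / n := by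
  have hn0 : (0 : ℝ) < n := by positivity
  have key : ∀ f : G, Integrable (fun ω => (empMean X n f ω - ∫ y, f.1 y ∂P) ^ 2) μ ∧
      ∫ ω, (empMean X n f ω - ∫ y, f.1 y ∂P) ^ 2 ∂μ ≤ (M + 1) / n := by
    intro f
    obtain ⟨h1, h2⟩ := integral_sq_empMean_sub_le hX hind (hGm f f.2) (hG2 f f.2) hn
    refine ⟨h1, h2.le.trans ?_⟩
    gcongr
    rw [variance_eq_integral (hGm f f.2).aemeasurable]
    have h3 : Integrable (fun x => (f.1 x - ∫ y, f.1 y ∂P) ^ 2) P :=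
      ((hG2 f f.2).sub (memLp_const _)).integrable_sq
    refine (integral_mono h3 ((hM f f.2).1.add (integrable_const 1)) fun x => ?_).trans ?_
    · simp only [Pi.add_apply]
      nlinarith [sq_nonneg ((f.1 x - ∫ y, f.1 y ∂P) ^ 2 - 1), sq_nonneg (f.1 x - ∫ y, f.1 y ∂P)]
    · simp only [Pi.add_apply]
      rw [integral_add (hM f f.2).1 (integrable_const 1)]
      simpa using (hM f f.2).2
  refine ⟨integrable_finsetSum _ fun f _ => (key f).1, ?_⟩
  rw [integral_finsetSum _ fun f _ => (key f).1]
  refine (Finset.sum_le_sum fun f _ => (key f).2).trans (le_of_eq ?_)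
  simp
  ring

/-- For a fixed sample size, `n χ²_{n,k}` is coupled with a `χ²_k`-distributed variable, namely the
squared length of the whitened Brownian bridge. The four error terms come from Markov's inequality
for the two parts of the error of the empirical covariance matrix, the strong approximation at level
`s`, and Markov's inequality for the `χ²_k` variable. -/
lemma exists_coupling {𝓕 : Set (E → ℝ)} {B : 𝓕 → Ω → ℝ} {Q : SignedMeasure E}
    (hX : ∀ i, HasLaw (X i) P μ) (hind : iIndepFun X μ) (hB : IsBrownianBridge P 𝓕 B μ)
    (h𝓕m : ∀ f ∈ 𝓕, Measurable f)
    (hM : ∀ f ∈ 𝓕, Integrable (fun x => (f x - ∫ y, f y ∂P) ^ 4) P ∧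
      ∫ x, (f x - ∫ y, f y ∂P) ^ 4 ∂P ≤ M)
    (hQ : Q Set.univ = 1) (hG : ∀ f ∈ G, f ∈ 𝓕)
    (hQG : ∀ f ∈ G, Q.Integrable f ∧ ∫ᵛ x, f x ∂<•Q = ∫ x, f x ∂P)
    {n : ℕ} (hn : 1 ≤ n) (hk : 1 ≤ G.card) (hl : 0 < minEigenvalue P G) {s p : ℝ}
    (hs : μ {ω | ENNReal.ofReal s ≤ ⨆ f : 𝓕, ENNReal.ofReal |gammaN X P n f ω - B f ω|} ≤
      ENNReal.ofReal p) :
    ∃ Y : G → Ω → ℝ, (∀ j, HasLaw (Y j) (gaussianReal 0 1) μ) ∧ iIndepFun Y μ ∧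
      ∀ K η : ℝ, 1 ≤ K → 0 < η → η ≤ 1 / 2 → (minEigenvalue P G)⁻¹ * G.card * s ^ 2 ≤ η ^ 2 →
        μ {ω | chiSq Q X n G ω = ⊤ ∨
            8 * K * η * √G.card < |n * (chiSq Q X n G ω).toReal - ∑ j, Y j ω ^ 2|} ≤
          ENNReal.ofReal (G.card ^ 2 * M / n / (η * minEigenvalue P G / (2 * √G.card)) ^ 2) +
          ENNReal.ofReal (G.card * (M + 1) / n / (η * minEigenvalue P G / (2 * √G.card))) +
          ENNReal.ofReal p + ENNReal.ofReal (1 / K) := by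
  classical
  set l := minEigenvalue P G with hldef
  set k : ℝ := (G.card : ℝ) with hkdef
  have hk1 : (1 : ℝ) ≤ k := by rw [hkdef]; exact_mod_cast hk
  have hsymm : (covMatrix P G).IsHermitian := by
    ext f g
    simp [covMatrix, covariance_comm]
  have hl' : l = sInf (spectrum ℝ (covMatrix P G)) := by
    rw [hldef, minEigenvalue]
  have hray : ∀ d : G → ℝ, l * (d ⬝ᵥ d) ≤ d ⬝ᵥ covMatrix P G *ᵥ d := by
    rw [hl']; exact sInf_spectrum_mul_dotProduct_le hsymm
  obtain ⟨A, hA⟩ := exists_conj_transpose_eq_one (posDef_of_sInf_spectrum_pos hsymm (hl' ▸ hl))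
  obtain ⟨hYl, hYi⟩ := hB.whiten hG hA
  set b : Ω → G → ℝ := fun ω f => B ⟨f, hG f f.2⟩ ω with hb
  refine ⟨fun j ω => (A *ᵥ b ω) j, hYl, hYi, fun K η hK hη hη2 hsη => ?_⟩
  set D : Ω → ℝ := fun ω => ∑ f : G, ∑ g : G, (empMean X n (fun x => (f.1 x - ∫ y, f.1 y ∂P) *
          (g.1 x - ∫ y, g.1 y ∂P)) ω - covMatrix P G f g) ^ 2 with hD
  set V : Ω → ℝ := fun ω => ∑ f : G, (empMean X n f ω - ∫ y, f.1 y ∂P) ^ 2 with hV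
  set Z : Ω → ℝ := fun ω => ∑ j, (A *ᵥ b ω) j ^ 2 with hZ
  set t : ℝ := η * l / (2 * √k) with ht
  have hsk : 0 < √k := Real.sqrt_pos.2 (by linarith)
  have ht0 : 0 < t := div_pos (mul_pos hη hl) (by linarith)
  have hD0 : ∀ ω, 0 ≤ D ω := fun ω =>
    Finset.sum_nonneg fun f _ => Finset.sum_nonneg fun g _ => sq_nonneg _
  have hV0 : ∀ ω, 0 ≤ V ω := fun ω => Finset.sum_nonneg fun f _ => sq_nonneg _
  have hGm : ∀ f ∈ G, Measurable f := fun f hf => h𝓕m f (hG f hf)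
  have hMG := fun f hf => hM f (hG f hf)
  obtain ⟨hDi, hDle⟩ := integral_sum_sq_empMean_sub_covMatrix_le hX hind hGm hMG hn
  obtain ⟨hVi, hVle⟩ := integral_sum_sq_empMean_sub_le hX hind hGm
    (fun f hf => hB.memLp f (hG f hf)) hMG hn
  have hZi : Integrable Z μ :=
    integrable_finsetSum _ fun j _ => (integral_sq_of_hasLaw (hYl j)).1
  have hZe : ∫ ω, Z ω ∂μ = k := by
    rw [hZ, integral_finsetSum _ fun j _ => (integral_sq_of_hasLaw (hYl j)).1,
      Finset.sum_congr rfl fun j _ => (integral_sq_of_hasLaw (hYl j)).2]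
    simp [hkdef]
  have e1 := measure_ge_le_ofReal_div hDi hD0 hDle (pow_pos ht0 2)
  have e2 := measure_ge_le_ofReal_div hVi hV0 hVle ht0
  have e4 := measure_ge_le_ofReal_div hZi (fun ω => Finset.sum_nonneg fun j _ => sq_nonneg _) hZe.le
    (show 0 < K * k by positivity)
  rw [show k / (K * k) = 1 / K by field_simp] at e4
  refine le_trans (measure_mono (t := (({ω | t ^ 2 ≤ D ω} ∪ {ω | t ≤ V ω}) ∪
    {ω | ENNReal.ofReal s ≤ ⨆ f : 𝓕, ENNReal.ofReal |gammaN X P n f ω - B f ω|}) ∪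
    {ω | K * k ≤ Z ω}) fun ω hω => ?_) ?_
  · by_contra hcon
    simp only [Set.mem_union, Set.mem_ofPred_eq, not_or, not_le] at hcon
    obtain ⟨⟨⟨c1, c2⟩, c3⟩, c4⟩ := hcon
    have hbb : (A *ᵥ b ω) ⬝ᵥ (A *ᵥ b ω) = Z ω := by
      simp [hZ, dotProduct, sq]
    have hs' : ∀ f : G, |gammaN X P n f ω - b ω f| ≤ s := fun f => by
      have h1 : ENNReal.ofReal |gammaN X P n f ω - b ω f| < ENNReal.ofReal s :=
        (le_iSup (fun g : 𝓕 => ENNReal.ofReal |gammaN X P n g ω - B g ω|)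
          ⟨f, hG f f.2⟩).trans_lt c3
      exact ((ENNReal.ofReal_lt_ofReal_iff_of_nonneg (abs_nonneg _)).1 h1).le
    obtain ⟨hne, hfin⟩ := abs_chiSq_sub_le_of_close hQ hQG hn hk hl hray hA hK hη hη2 hsη ω (b ω)
      c1 c2 hs' (by rw [hbb]; exact c4.le)
    rw [hbb] at hfin
    rcases hω with hω | hω
    · exact hne hω
    · exact absurd hfin (not_le.2 hω)
  · refine (measure_union_le _ _).trans (add_le_add ((measure_union_le _ _).trans
      (add_le_add ((measure_union_le _ _).trans (add_le_add e1 e2)) hs)) e4)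

end FiniteSample

/-! ### Passage to the limit -/

section Asymptotics

variable {E : Type*} [MeasurableSpace E]

lemma measurable_chiSq_sieve {Ω : Type*} [MeasurableSpace Ω] {Q : SignedMeasure E}
    (hQ : Q Set.univ = 1) {G : ℕ → Finset (E → ℝ)} {a : (E → ℝ) → ℝ}
    (hG : ∀ n, 1 ≤ n → ∀ f ∈ G n, Q.Integrable f ∧ ∫ᵛ x, f x ∂<•Q = a f)
    (hGm : ∀ n, 1 ≤ n → ∀ f ∈ G n, Measurable f) {X : ℕ → Ω → E} (hX : ∀ i, Measurable (X i))
    (n : ℕ) : Measurable (chiSq Q X n (G n)) := by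
  rcases Nat.eq_zero_or_pos n with rfl | hn
  · -- the empirical measure of the empty sample is `0` by the convention `0⁻¹ = 0`
    have : chiSq Q X 0 (G 0) = fun _ =>
        ⨆ f ∈ Submodule.span ℝ (insert 1 (G 0 : Set (E → ℝ))), ((∫ᵛ x, f x ∂<•Q : ℝ) : EReal) := by
      ext ω
      simp [chiSq, empMean]
    rw [this]
    exact measurable_const
  · exact measurable_chiSq hQ (hG n hn) (hGm n hn) hX hn

/-- The law of the sequence of observations, hence of every statistic, does not depend on the
probability space which carries the observations. -/
lemma hasLaw_sample {Ω : Type*} [MeasurableSpace Ω] {μ : Measure Ω}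
    {P : Measure E} [IsProbabilityMeasure P] {X : ℕ → Ω → E}
    (hX : ∀ i, HasLaw (X i) P μ) (hind : iIndepFun X μ) :
    HasLaw (fun ω i => X i ω) (Measure.infinitePi fun _ : ℕ => P) μ :=
  hind.hasLaw_infinitePi hX (aemeasurable_pi_lambda _ fun i => (hX i).aemeasurable)

/-- The two error terms of `exists_coupling` from the empirical covariance matrix are the square of
`ρ_n = λ⁻¹ k^{3/2} n^{-1/2}`, and `ρ_n n^{-1/2}`, up to constants. -/
lemma tendsto_covariance_error {k : ℕ → ℕ} {l : ℕ → ℝ}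
    (hD : Tendsto (fun n : ℕ => (l n)⁻¹ * (k n : ℝ) ^ (3 / 2 : ℝ) * (n : ℝ) ^ (-1 / 2 : ℝ))
      atTop (𝓝 0)) (M η : ℝ) :
    Tendsto (fun n : ℕ => (k n : ℝ) ^ 2 * M / n / (η * l n / (2 * √(k n))) ^ 2) atTop (𝓝 0) ∧
    Tendsto (fun n : ℕ => k n * (M + 1) / n / (η * l n / (2 * √(k n)))) atTop (𝓝 0) := by
  have hk : ∀ n, (k n : ℝ) ^ (3 / 2 : ℝ) = k n * √(k n) := fun n => by
    rw [show (3 / 2 : ℝ) = 1 + 1 / 2 by norm_num, Real.rpow_add' (by positivity) (by norm_num),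
      Real.rpow_one, Real.sqrt_eq_rpow]
  have hn : ∀ n : ℕ, (n : ℝ) ^ (-1 / 2 : ℝ) = (√n)⁻¹ := fun n => by
    rw [neg_div, Real.rpow_neg (by positivity), Real.sqrt_eq_rpow]
  simp only [hk, hn] at hD
  have hinv : Tendsto (fun n : ℕ => (√(n : ℝ))⁻¹) atTop (𝓝 0) :=
    tendsto_inv_atTop_zero.comp (Real.tendsto_sqrt_atTop.comp tendsto_natCast_atTop_atTop)
  constructor
  · have h := (hD.pow 2).const_mul (4 * M / η ^ 2)
    simp only [ne_eq, OfNat.ofNat_ne_zero, not_false_eq_true, zero_pow, mul_zero] at h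
    refine h.congr fun n => ?_
    have h1 : √(k n : ℝ) ^ 2 = k n := Real.sq_sqrt (by positivity)
    have h2 : √(n : ℝ) ^ 2 = n := Real.sq_sqrt (by positivity)
    simp only [div_eq_mul_inv, mul_inv, mul_pow, inv_pow, inv_inv, h1, h2]
    ring
  · have h := (hD.mul hinv).const_mul (2 * (M + 1) / η)
    simp only [mul_zero] at h
    refine h.congr fun n => ?_
    have h2 : (√(n : ℝ))⁻¹ * (√(n : ℝ))⁻¹ = (n : ℝ)⁻¹ := by
      rw [← mul_inv, Real.mul_self_sqrt (by positivity)]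
    simp only [div_eq_mul_inv, mul_inv, inv_inv]
    linear_combination (2 * (M + 1) * η⁻¹ * ((l n)⁻¹ * (k n * √(k n)))) * h2

/-- The statement on the probability space that carries the Brownian bridges. -/
lemma tendsto_on_strong_approximation_space {Ω : Type*} [MeasurableSpace Ω] {μ : Measure Ω}
    [IsProbabilityMeasure μ] {P : Measure E} [IsProbabilityMeasure P] {X : ℕ → Ω → E}
    (hX : ∀ i, HasLaw (X i) P μ) (hind : iIndepFun X μ) {𝓕 : Set (E → ℝ)}
    (h𝓕m : ∀ f ∈ 𝓕, Measurable f) {M : ℝ}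
    (hM : ∀ f ∈ 𝓕, Integrable (fun x => (f x - ∫ y, f y ∂P) ^ 4) P ∧
      ∫ x, (f x - ∫ y, f y ∂P) ^ 4 ∂P ≤ M)
    {B : ℕ → 𝓕 → Ω → ℝ} (hB : ∀ n, 1 ≤ n → IsBrownianBridge P 𝓕 (B n) μ) {b c θ : ℝ}
    (hθ : 0 < θ) {δ : ℕ → ℝ}
    (hK : ∀ n : ℕ, 1 ≤ n → ∀ t : ℝ, 0 < t →
      μ {ω | ENNReal.ofReal (δ n * (t + b * Real.log n)) ≤
          ⨆ f : 𝓕, ENNReal.ofReal |gammaN X P n f ω - B n f ω|} ≤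
        ENNReal.ofReal (c * Real.exp (-θ * t)))
    {Q : SignedMeasure E} (hQ : Q Set.univ = 1)
    (hQP : ∀ f ∈ 𝓕, Q.Integrable f ∧ ∫ᵛ x, f x ∂<•Q = ∫ x, f x ∂P)
    {G : ℕ → Finset (E → ℝ)} (hG : ∀ n, 1 ≤ n → ∀ f ∈ G n, f ∈ 𝓕)
    (hk : Tendsto (fun n => (G n).card) atTop atTop)
    (hl : ∀ᶠ n in atTop, 0 < minEigenvalue P (G n))
    (hBr : Tendsto (fun n : ℕ => minEigenvalue P (G n) ^ (-1 / 2 : ℝ) *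
      ((G n).card : ℝ) ^ (1 / 2 : ℝ) * δ n * Real.log n) atTop (𝓝 0))
    (hDr : Tendsto (fun n : ℕ => (minEigenvalue P (G n))⁻¹ *
      ((G n).card : ℝ) ^ (3 / 2 : ℝ) * (n : ℝ) ^ (-1 / 2 : ℝ)) atTop (𝓝 0))
    (hmeas : ∀ n, AEMeasurable (standardizedChiSq Q X n (G n)) μ) :
    Tendsto (fun n => μ {ω | chiSq Q X n (G n) ω = ⊤}) atTop (𝓝 0) ∧
    TendstoInDistribution (fun n => standardizedChiSq Q X n (G n)) atTop
      (id : ℝ → ℝ) (fun _ => μ) (gaussianReal 0 1) := by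
  obtain ⟨Ω₀, _, μ₀, ξ, -, hξ, hξi, _⟩ := exists_iid ℕ (gaussianReal 0 1)
  have hclt := tendstoInDistribution_sum_sq hξ hξi
  -- where the coupling is not available, `0` takes the place of the `χ²` variable
  have hZ : ∀ n, ∃ Z : Ω → ℝ, AEMeasurable Z μ ∧
      ((2 ≤ n ∧ 1 ≤ (G n).card ∧ 0 < minEigenvalue P (G n)) →
        μ.map Z = μ₀.map (fun ω => ∑ i ∈ Finset.range (G n).card, ξ i ω ^ 2) ∧
        ∀ K η : ℝ, 1 ≤ K → 0 < η → η ≤ 1 / 2 → (minEigenvalue P (G n))⁻¹ * (G n).card *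
            (δ n * (Real.log n + b * Real.log n)) ^ 2 ≤ η ^ 2 →
          μ {ω | chiSq Q X n (G n) ω = ⊤ ∨
            8 * K * η * √(G n).card < |n * (chiSq Q X n (G n) ω).toReal - Z ω|} ≤
          ENNReal.ofReal ((G n).card ^ 2 * M / n /
            (η * minEigenvalue P (G n) / (2 * √(G n).card)) ^ 2) +
          ENNReal.ofReal ((G n).card * (M + 1) / n /
            (η * minEigenvalue P (G n) / (2 * √(G n).card))) +
          ENNReal.ofReal (c * Real.exp (-θ * Real.log n)) + ENNReal.ofReal (1 / K)) := by
    intro n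
    by_cases hn : 2 ≤ n ∧ 1 ≤ (G n).card ∧ 0 < minEigenvalue P (G n)
    swap
    · exact ⟨0, aemeasurable_const, fun h => absurd h hn⟩
    obtain ⟨hn2, hk1, hl0⟩ := hn
    have hn1 : 1 ≤ n := by omega
    have hlog : 0 < Real.log n := Real.log_pos (by exact_mod_cast hn2)
    obtain ⟨Y, hYl, hYi, hY⟩ := exists_coupling hX hind (hB n hn1) h𝓕m hM hQ (hG n hn1)
      (fun f hf => hQP f (hG n hn1 f hf)) hn1 hk1 hl0 (hK n hn1 _ hlog)
    refine ⟨fun ω => ∑ j, Y j ω ^ 2, ?_, fun _ => ⟨?_, hY⟩⟩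
    · have := fun j => (hYl j).aemeasurable
      fun_prop
    · rw [map_sum_sq_eq ((G n).equivFin) hYl hYi (fun i : Fin (G n).card => hξ i)
        (hξi.precomp Fin.val_injective)]
      congr with ω
      exact Fin.sum_univ_eq_sum_range (fun i => ξ i ω ^ 2) _
  choose Z hZm hZ using hZ
  have hgood : ∀ᶠ n in atTop, 2 ≤ n ∧ 1 ≤ (G n).card ∧ 0 < minEigenvalue P (G n) :=
    (eventually_ge_atTop 2).and ((hk.eventually_ge_atTop 1).and hl)
  have key : ∀ ε : ℝ, 0 < ε → Tendsto (fun n => μ {ω | chiSq Q X n (G n) ω = ⊤ ∨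
      ε * √(G n).card < |n * (chiSq Q X n (G n) ω).toReal - Z n ω|}) atTop (𝓝 0) := by
    intro ε hε
    refine ENNReal.tendsto_nhds_zero.2 fun τ hτ => ?_
    obtain ⟨r, hr0, hr, hrτ⟩ := ENNReal.lt_iff_exists_real_btwn.1 hτ
    rw [ENNReal.ofReal_pos] at hr
    -- `1 / K` takes half of the admissible probability, and `8 K η` is at most `ε`
    set K : ℝ := max 1 (2 / r) with hKdef
    have hK1 : 1 ≤ K := le_max_left _ _
    have hKr : 1 / K ≤ r / 2 := by
      have : 2 / r ≤ K := le_max_right _ _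
      rw [div_le_iff₀ (by positivity)] at this ⊢
      linarith
    set η : ℝ := min (1 / 2) (ε / (8 * K)) with hηdef
    have hη : 0 < η := lt_min (by norm_num) (by positivity)
    have hη8 : 8 * K * η ≤ ε := by
      have : η ≤ ε / (8 * K) := min_le_right _ _
      rwa [le_div_iff₀ (by positivity), mul_comm] at this
    obtain ⟨hu1, hu2⟩ := tendsto_covariance_error hDr M η
    have hu3 : Tendsto (fun n : ℕ => c * Real.exp (-θ * Real.log n)) atTop (𝓝 0) := by
      have h1 : Tendsto (fun n : ℕ => θ * Real.log n) atTop atTop :=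
        (Real.tendsto_log_atTop.comp tendsto_natCast_atTop_atTop).const_mul_atTop hθ
      have h2 := (Real.tendsto_exp_neg_atTop_nhds_zero.comp h1).const_mul c
      simpa [Function.comp_def] using h2
    have hsum : Tendsto (fun n : ℕ =>
        ENNReal.ofReal ((G n).card ^ 2 * M / n /
          (η * minEigenvalue P (G n) / (2 * √(G n).card)) ^ 2) +
        ENNReal.ofReal ((G n).card * (M + 1) / n /
          (η * minEigenvalue P (G n) / (2 * √(G n).card))) +
        ENNReal.ofReal (c * Real.exp (-θ * Real.log n))) atTop (𝓝 0) := by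
      simpa using ((ENNReal.tendsto_ofReal hu1).add (ENNReal.tendsto_ofReal hu2)).add
        (ENNReal.tendsto_ofReal hu3)
    have hs := (hBr.mul_const (1 + b)).pow 2
    simp only [zero_mul, ne_eq, OfNat.ofNat_ne_zero, not_false_eq_true, zero_pow] at hs
    filter_upwards [hgood, ENNReal.tendsto_nhds_zero.1 hsum (ENNReal.ofReal (r / 2))
      (ENNReal.ofReal_pos.2 (by positivity)), hs.eventually_le_const (pow_pos hη 2)]
      with n hn hn2 hn3
    refine le_trans (measure_mono fun ω hω => ?_) (((hZ n hn).2 K η hK1 hη (min_le_left _ _)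
      ?_).trans ?_)
    · rcases hω with hω | hω
      · exact Or.inl hω
      · exact Or.inr (lt_of_le_of_lt (by gcongr) hω)
    · refine le_trans (le_of_eq ?_) hn3
      have e1 : (minEigenvalue P (G n) ^ (-1 / 2 : ℝ)) ^ 2 = (minEigenvalue P (G n))⁻¹ := by
        rw [← Real.rpow_natCast, ← Real.rpow_mul hn.2.2.le, ← Real.rpow_neg_one]
        norm_num
      have e2 : (((G n).card : ℝ) ^ (1 / 2 : ℝ)) ^ 2 = (G n).card := by
        rw [← Real.sqrt_eq_rpow, Real.sq_sqrt (by positivity)]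
      simp only [mul_pow, e1, e2]
      ring
    · refine (add_le_add hn2 (ENNReal.ofReal_le_ofReal hKr)).trans ?_
      rw [← ENNReal.ofReal_add (by positivity) (by positivity), add_halves]
      exact hrτ.le
  constructor
  · refine tendsto_of_tendsto_of_tendsto_of_le_of_le tendsto_const_nhds (key 1 one_pos)
      (fun _ => zero_le) fun n => measure_mono fun ω hω => Or.inl hω
  · have hZm' : ∀ n, AEMeasurable (fun ω => (Z n ω - (G n).card) / √(2 * (G n).card)) μ :=
      fun n => ((hZm n).sub_const _).div_const _
    have hZlim : TendstoInDistribution (fun n ω => (Z n ω - (G n).card) / √(2 * (G n).card)) atTop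
        (id : ℝ → ℝ) (fun _ => μ) (gaussianReal 0 1) := by
      refine ⟨hZm', aemeasurable_id, (hclt.tendsto.comp hk).congr' ?_⟩
      filter_upwards [hgood] with n hn
      refine Subtype.ext ?_
      have hg : Measurable fun z : ℝ => (z - (G n).card) / √(2 * (G n).card) := by fun_prop
      have hS : AEMeasurable (fun ω => ∑ i ∈ Finset.range (G n).card, ξ i ω ^ 2) μ₀ := by
        have := fun i => (hξ i).aemeasurable
        fun_prop
      have h1 := AEMeasurable.map_map_of_aemeasurable hg.aemeasurable (hZm n)
      have h2 := AEMeasurable.map_map_of_aemeasurable hg.aemeasurable hS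
      rw [(hZ n hn).1] at h1
      exact h2.symm.trans h1
    refine tendstoInDistribution_of_tendstoInMeasure_sub _ _ hZlim ?_ hmeas
    rw [tendstoInMeasure_iff_norm]
    intro ε hε
    refine tendsto_of_tendsto_of_tendsto_of_le_of_le' tendsto_const_nhds (key (ε / 2) (by positivity))
      (.of_forall fun _ => zero_le) ?_
    filter_upwards [hgood] with n hn
    refine measure_mono fun ω hω => Or.inr ?_
    have hk0 : (0 : ℝ) < (G n).card := by exact_mod_cast hn.2.1
    have hω' : ε ≤ |n * (chiSq Q X n (G n) ω).toReal - Z n ω| / √(2 * (G n).card) := by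
      have : ε ≤ ‖standardizedChiSq Q X n (G n) ω - (Z n ω - (G n).card) / √(2 * (G n).card) - 0‖ :=
        hω
      rwa [sub_zero, standardizedChiSq, ← sub_div, sub_sub_sub_cancel_right, Real.norm_eq_abs,
        abs_div, abs_of_nonneg (Real.sqrt_nonneg _)] at this
    rw [le_div_iff₀ (by positivity)] at hω'
    refine lt_of_lt_of_le ?_ hω'
    have h1 : √((G n).card : ℝ) ≤ √(2 * (G n).card) := Real.sqrt_le_sqrt (by linarith)
    have h2 : 0 < √((G n).card : ℝ) := Real.sqrt_pos.2 hk0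
    nlinarith

end Asymptotics

end ChiSquareSieve

end

theorem mainTheorem2 {d : ℕ}
    -- the law `P` of the observations and the i.i.d. sample
    (P : Measure (EuclideanSpace ℝ (Fin d))) [IsProbabilityMeasure P]
    {Ω : Type*} [MeasurableSpace Ω] (μ : Measure Ω) [IsProbabilityMeasure μ]
    (X : ℕ → Ω → EuclideanSpace ℝ (Fin d))
    (hX_law : ∀ i, HasLaw (X i) P μ) (hX_indep : iIndepFun X μ)
    -- the class `𝓕`, its envelope, the KMT property
    (𝓕 : Set (EuclideanSpace ℝ (Fin d) → ℝ)) (h𝓕_meas : ∀ f ∈ 𝓕, Measurable f)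
    (F : EuclideanSpace ℝ (Fin d) → ℝ) (hF : ∀ f ∈ 𝓕, ∀ x, |f x| ≤ F x)
    (δ : ℕ → ℝ) (hδ_anti : AntitoneOn δ (Set.Ici 1)) (hδ_lim : Tendsto δ atTop (𝓝 0))
    (hKMT : ChiSquareSieve.IsKMT δ P 𝓕)
    -- the constraints, a fixed `Q₀` satisfying them, and the null hypothesis `P ∈ Ω`
    (a : (EuclideanSpace ℝ (Fin d) → ℝ) → ℝ)
    (Q₀ : SignedMeasure (EuclideanSpace ℝ (Fin d)))
    (hQ₀ : Q₀ ∈ ChiSquareSieve.constraintSet 𝓕 a)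
    (hH0 : P.toSignedMeasure ∈ ChiSquareSieve.constraintSet 𝓕 a)
    -- the sieve
    (𝓕s : ℕ → Finset (EuclideanSpace ℝ (Fin d) → ℝ))
    (h_sub : ∀ n, 1 ≤ n → (𝓕s n : Set (EuclideanSpace ℝ (Fin d) → ℝ)) ⊆ 𝓕)
    (h_mono : ∀ n, 1 ≤ n → 𝓕s n ⊆ 𝓕s (n + 1))
    (h_indep : ∀ n, 1 ≤ n →
      LinearIndependent ℝ (fun f : 𝓕s n => (f : EuclideanSpace ℝ (Fin d) → ℝ)))
    -- the growth conditions
    (hk : Tendsto (fun n => (𝓕s n).card) atTop atTop)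
    (hl_pos : ∀ᶠ n in atTop, 0 < ChiSquareSieve.minEigenvalue P (𝓕s n))
    (hB : Tendsto (fun n : ℕ => ChiSquareSieve.minEigenvalue P (𝓕s n) ^ (-1 / 2 : ℝ) *
      ((𝓕s n).card : ℝ) ^ (1 / 2 : ℝ) * δ n * Real.log n) atTop (𝓝 0))
    (hD : Tendsto (fun n : ℕ => (ChiSquareSieve.minEigenvalue P (𝓕s n))⁻¹ *
      ((𝓕s n).card : ℝ) ^ (3 / 2 : ℝ) * (n : ℝ) ^ (-1 / 2 : ℝ)) atTop (𝓝 0)) :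
    Tendsto (fun n => μ {ω | ChiSquareSieve.chiSq Q₀ X n (𝓕s n) ω = ⊤}) atTop (𝓝 0) ∧
    TendstoInDistribution
      (fun n => ChiSquareSieve.standardizedChiSq Q₀ X n (𝓕s n)) atTop
      (id : ℝ → ℝ) (fun _ => μ) (gaussianReal 0 1) := by
  classical
  obtain ⟨M, hM⟩ := hKMT.exists_integral_pow_four_le h𝓕_meas
  obtain ⟨-, Ω', _, μ', X', B, b, c, θ, _, hX', hind', hB', -, -, hθ, hK⟩ := hKMT
  have hP : ∀ f ∈ 𝓕, ∫ x, f x ∂P = a f := fun f hf => by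
    rw [← (hH0.2 f hf).2, VectorMeasure.integral_toSignedMeasure]
  have hQP : ∀ f ∈ 𝓕, Q₀.Integrable f ∧ ∫ᵛ x, f x ∂<•Q₀ = ∫ x, f x ∂P := fun f hf => by
    rw [hP f hf]
    exact hQ₀.2 f hf
  -- both samples are read off the same sequence space
  set Φ : ℕ → (ℕ → EuclideanSpace ℝ (Fin d)) → EReal := fun n =>
    ChiSquareSieve.chiSq Q₀ (fun i x => x i) n (𝓕s n) with hΦ
  set Ψ : ℕ → (ℕ → EuclideanSpace ℝ (Fin d)) → ℝ := fun n =>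
    ChiSquareSieve.standardizedChiSq Q₀ (fun i x => x i) n (𝓕s n) with hΨ
  have hΦm : ∀ n, Measurable (Φ n) := fun n =>
    ChiSquareSieve.measurable_chiSq_sieve hQ₀.1 (fun n hn f hf => hQ₀.2 f (h_sub n hn hf))
      (fun n hn f hf => h𝓕_meas f (h_sub n hn hf)) (fun i => measurable_pi_apply i) n
  have hΨm : ∀ n, Measurable (Ψ n) := fun n =>
    (((hΦm n).ereal_toReal.const_mul _).sub_const _).div_const _
  have hL := ChiSquareSieve.hasLaw_sample hX_law hX_indep
  have hL' := ChiSquareSieve.hasLaw_sample hX' hind'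
  have hmeas : ∀ n, AEMeasurable (ChiSquareSieve.standardizedChiSq Q₀ X n (𝓕s n)) μ :=
    fun n => (hΨm n).comp_aemeasurable hL.aemeasurable
  have hmeas' : ∀ n, AEMeasurable (ChiSquareSieve.standardizedChiSq Q₀ X' n (𝓕s n)) μ' :=
    fun n => (hΨm n).comp_aemeasurable hL'.aemeasurable
  obtain ⟨h1, h2⟩ := ChiSquareSieve.tendsto_on_strong_approximation_space hX' hind' h𝓕_meas hM hB'
    hθ hK hQ₀.1 hQP (fun n hn f hf => h_sub n hn hf) hk hl_pos hB hD hmeas'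
  refine ⟨h1.congr fun n => ?_, ⟨hmeas, aemeasurable_id, h2.tendsto.congr fun n => ?_⟩⟩
  · have hs : MeasurableSet {x | Φ n x = ⊤} := hΦm n (measurableSet_singleton _)
    have e := Measure.map_apply_of_aemeasurable hL.aemeasurable hs
    have e' := Measure.map_apply_of_aemeasurable hL'.aemeasurable hs
    rw [hL.map_eq] at e
    rw [hL'.map_eq] at e'
    exact e'.symm.trans e
  · refine Subtype.ext ?_
    have e := AEMeasurable.map_map_of_aemeasurable (hΨm n).aemeasurable hL.aemeasurable
    have e' := AEMeasurable.map_map_of_aemeasurable (hΨm n).aemeasurable hL'.aemeasurable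
    rw [hL.map_eq] at e
    rw [hL'.map_eq] at e'
    exact e'.symm.trans e
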